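/- Let $S^1\subset\mathbb R^2$ be the unit circle and $P:[0,2\pi)\to S^1$, $P(t)=(\cos t,\sin t)$. A smooth map $f:S^1\to S^1$ is *$C^\infty$-stable* if it has a neighbourhood in the (Whitney) $C^\infty$-topology on $C^\infty(S^1,S^1)$ all of whose members are $\mathcal A_\infty$-equivalent to $f$; here $f$ and $g$ are *$\mathcal A_\infty$-equivalent*, $f\sim_{\mathcal A_\infty}g$, if there are $C^\infty$ diffeomorphisms $h,k$ of $S^1$ with $k\circ f=g\circ h$. For a $C^\infty$-stable $f$ let $\Sigma(f)$ be its set of singular points (the points where $df=0$), and let $M(f)=f^{-1}(f(\Sigma(f)))$ if $\Sigma(f)\neq\emptyset$, and $M(f)=f^{-1}(1)$, with $1=(1,0)$, if $\Sigma(f)=\emptyset$. The set $M(f)$ is finite; let $N(f)$ be its number of points and let $a_1<a_2<\dots<a_{N(f)}$ be the elements of $P^{-1}(M(f))$. The associated tuple of $f$ is $\mathrm{Ast}(f)=(T(a_1),\dots,T(a_{N(f)}))\in\{s,p\}^{N(f)}$, where $T(a)=s$ if $P(a)\in\Sigma(f)$ and $T(a)=p$ otherwise. A permutation of $\mathbb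 Z/k\mathbb Z$ is *legal* if it is of the form $x\mapsto x+a$ or $x\mapsto -x+a$ for some $a\in\mathbb Z/k\mathbb Z$. For $t,t'\in\{s,p\}^k$ write $[t]_E=[t']_E$ if, identifying the index set $\{1,\dots,k\}$ with $\mathbb Z/k\mathbb Z$, there is a legal permutation $\rho$ with $t_i=t'_{\rho(i)}$ for all $i$. **Theorem.** Let $f,g:S^1\to S^1$ be $C^\infty$-stable. Then $$f\sim_{\mathcal A_\infty}g\iff N(f)=N(g)\ \text{ and }\ [\mathrm{Ast}(f)]_E=[\mathrm{Ast}(g)]_E .$$ -/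

import Mathlib

open scoped Manifold ContDiff

noncomputable section

namespace CircleMaps

/-- The set of smooth mappings from the circle to itself. The circle is compact, so all of
them are proper. -/
abbrev SmoothMap : Type := C^∞⟮𝓡 1, Circle; 𝓡 1, Circle⟯

/-- Smooth equivalence: there are smooth diffeomorphisms `h` of the source and `k` of the target
with `k ∘ f = g ∘ h`. -/
def SmoothEquiv (f g : SmoothMap) : Prop :=
  ∃ h k : Circle ≃ₘ^∞⟮𝓡 1, 𝓡 1⟯ Circle, ∀ x : Circle, k (f x) = g (h x)

/-- The map `t ↦ f (cos t, sin t)`, regarded as a curve in the plane `ℂ`. -/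
def curve (f : SmoothMap) (t : ℝ) : ℂ := (f (Circle.exp t) : ℂ)

/-- The basic neighbourhood of `f` in the smooth topology consisting of all smooth `g` whose
derivatives of order at most `r` with respect to the angle are uniformly `ε`-close to those
of `f`. As `r` and `ε` vary, these sets form a neighbourhood basis of `f` in the Whitney
topology (the circle is compact and embedded in the plane). -/
def basicNhd (f : SmoothMap) (r : ℕ) (ε : ℝ) : Set SmoothMap :=
  {g | ∀ k ≤ r, ∀ t : ℝ, ‖iteratedDeriv k (curve g) t - iteratedDeriv k (curve f) t‖ < ε}

/-- `f` is stable if some neighbourhood of `f` in the smooth topology consists of maps that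
are smoothly equivalent to `f`. -/
def IsStable (f : SmoothMap) : Prop :=
  ∃ r : ℕ, ∃ ε > (0 : ℝ), ∀ g ∈ basicNhd f r ε, SmoothEquiv f g

/-- The set of singular points of `f`. -/
def singularSet (f : SmoothMap) : Set Circle :=
  {x | mfderiv (𝓡 1) (𝓡 1) f x = 0}

/-- The discriminant of `f`, that is, its set of singular values. -/
def discriminant (f : SmoothMap) : Set Circle := f '' singularSet f

open scoped Classical in
/-- The points of the source that are registered by the associated tuple: all singular points
together with all other preimages of singular values, or, if there are no singular points, the
preimages of the point `1 = (1, 0)`. -/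
def markedPoints (f : SmoothMap) : Set Circle :=
  if singularSet f = ∅ then f ⁻¹' {1} else f ⁻¹' discriminant f

/-- The angles in `[0, 2π)` of the marked points. -/
def angleSet (f : SmoothMap) : Set ℝ :=
  {t | t ∈ Set.Ico 0 (2 * Real.pi) ∧ Circle.exp t ∈ markedPoints f}

open scoped Classical in
/-- The angles of the marked points as a finite set. For a stable map there are only finitely
many; the value for infinitely many is immaterial. -/
def angles (f : SmoothMap) : Finset ℝ :=
  if h : (angleSet f).Finite then h.toFinset else ∅

/-- The number `N(f)` of marked points. -/
def N (f : SmoothMap) : ℕ := (angles f).card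

/-- The two symbols `s` (singular) and `p` (regular preimage). -/
inductive Letter : Type
  | s : Letter
  | p : Letter

open scoped Classical in
/-- The symbol at the angle `t`. -/
def letterAt (f : SmoothMap) (t : ℝ) : Letter :=
  if Circle.exp t ∈ singularSet f then Letter.s else Letter.p

/-- The associated tuple `Ast(f)`: the symbols at the marked angles `a₁ < a₂ < ⋯ < a_N`. -/
def Ast (f : SmoothMap) : Fin (N f) → Letter :=
  fun i => letterAt f ((angles f).orderEmbOfFin rfl i)

/-- Cyclic shifts `[x] ↦ [x + a]` of `ℤ/k`. -/
def IsSwitch {k : ℕ} (σ : Equiv.Perm (ZMod k)) : Prop :=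
  ∃ a : ZMod k, ∀ x : ZMod k, σ x = x + a

/-- The reversal `[x] ↦ [-x]` of `ℤ/k`. -/
def reversation (k : ℕ) : Equiv.Perm (ZMod k) := Equiv.neg (ZMod k)

/-- The legal permutations `σ ∘ τ`, where `σ` is a switch and `τ` is the identity or the
reversal. -/
def IsLegal {k : ℕ} (ρ : Equiv.Perm (ZMod k)) : Prop :=
  ∃ σ τ : Equiv.Perm (ZMod k), IsSwitch σ ∧ (τ = 1 ∨ τ = reversation k) ∧ ρ = σ * τ

/-- The class modulo `k` of the position of an entry of a `k`-tuple. Positions are counted from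
`1` to `k`, and `i : Fin k` stands for the position `i + 1`. -/
def position {k : ℕ} (i : Fin k) : ZMod k := ((i : ℕ) + 1 : ℕ)

/-- Two `k`-tuples agree up to a legal permutation `ρ` of their positions:
`t_i = t'_{ρ(i)}` for all `i`. -/
def LegalRel {X : Type*} {k : ℕ} (t t' : Fin k → X) : Prop :=
  ∃ ρ : Equiv.Perm (ZMod k), IsLegal ρ ∧
    ∀ i j : Fin k, position j = ρ (position i) → t i = t' j

end CircleMaps

end

open scoped Manifold ContDiff

namespace CircleMaps

attribute [local instance] finrank_real_complex_fact'

/-! Stability enters only through general position. Maps whose critical points are all nondegenerate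
and have pairwise distinct values (`HasSimpleFolds`) are dense, and equivalence preserves this
property. A stable map is equivalent to such maps arbitrarily near it, so it has the property itself
(`IsStable.hasSimpleFolds`). From there on the argument concerns lifts `F : ℝ → ℝ` and equivariant
diffeomorphisms of the line (`smoothEquiv_iff`).

Marked points and marked values lift to increasing periodic sequences `a` and `v`. Between
neighbouring marked points `F` has no critical point and meets no marked value, so it runs
monotonically from some `v j` to `v (j + 1)` or `v (j - 1)`. The direction flips at a letter `s` and
persists at a letter `p`. The values at the marked points therefore form a walk on `ℤ` which the
tuple determines up to starting point and initial direction (`IsFoldWalk`). As critical values are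
distinct, the number of marked values is the larger of 1 and the number of letters `s`, so the tuple
determines it too.

Let the tuples agree up to a legal permutation. A cyclic shift is a reindexing, the reversal is a
reflection of the source, and opposite initial directions are cured by a reflection of the target. A
diffeomorphism `K` of the target then matches the value sequences
(`IsAngleSeq.exists_isEquivariantDiffeo`), and `K ∘ F = G ∘ H` is solved for `H` interval by
interval (`IsMarking.exists_conj`). Smoothness of `H` follows from the inverse function theorem off
the folds and from the quadratic normal form at the folds (`contDiff_of_conj`).

Conversely, if there are singular points, the source diffeomorphism of an equivalence carries marked
points to marked points, hence acts on their indices by `i ↦ ±i + c` (`IsAngleSeq.eq_affine`).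
Without singular points the base value 1 need not be preserved, but `N` is then the absolute degree
and every letter is `p`. -/

/-! ### Smooth lifts of circle maps to the line -/

theorem contMDiff_circle_coe :
    ContMDiff (𝓡 1) 𝓘(ℝ, ℂ) ∞ (fun z : Circle => (z : ℂ)) :=
  contMDiff_coe_sphere (E := ℂ) (n := 1)

/-- Near any point of the circle, the angle can be chosen smoothly. -/
theorem exists_smooth_angle (x : Circle) :
    ∃ s : Circle → ℝ, ContMDiffAt (𝓡 1) 𝓘(ℝ, ℝ) ∞ s x ∧ ∀ z, Circle.exp (s z) = z := by
  -- Dividing by `x` moves the base point to 1, away from the branch cut of the logarithm.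
  refine ⟨fun z => Complex.arg ((z / x : Circle) : ℂ) + Complex.arg (x : ℂ), ?_, fun z => ?_⟩
  · have h1 : ContMDiffAt (𝓡 1) (𝓡 1) ∞ (fun z : Circle => z * x⁻¹) x :=
      (contMDiff_mul_right (I := 𝓡 1) (n := ∞) (a := x⁻¹)).contMDiffAt
    have h2 : ContMDiffAt (𝓡 1) 𝓘(ℝ, ℂ) ∞ (fun z : Circle => ((z * x⁻¹ : Circle) : ℂ)) x :=
      contMDiff_circle_coe.contMDiffAt.comp x h1
    have h3 : ContDiffAt ℝ ∞ (fun z : ℂ => (Complex.log z).im + Complex.arg (x : ℂ))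
        ((x * x⁻¹ : Circle) : ℂ) := by
      have : ContDiffAt ℝ ∞ Complex.log ((x * x⁻¹ : Circle) : ℂ) :=
        (Complex.contDiffAt_log (n := ∞) (by simp)).restrict_scalars ℝ
      exact (Complex.imCLM.contDiff.contDiffAt.comp _ this).add contDiffAt_const
    have h4 := h3.contMDiffAt.comp x h2
    refine h4.congr_of_eventuallyEq (Filter.Eventually.of_forall fun z => ?_)
    simp [Complex.log_im, div_eq_mul_inv]
  · rw [Circle.exp_add, Circle.exp_arg, Circle.exp_arg, div_mul_cancel]

theorem contMDiff_of_comp_exp {f : Circle → Circle}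
    (h : ContMDiff 𝓘(ℝ, ℝ) (𝓡 1) ∞ (fun t => f (Circle.exp t))) :
    ContMDiff (𝓡 1) (𝓡 1) ∞ f := by
  intro x
  obtain ⟨s, hs, hsx⟩ := exists_smooth_angle x
  have := (h (s x)).comp x hs
  refine this.congr_of_eventuallyEq (Filter.Eventually.of_forall fun z => ?_)
  simp [hsx]

/-- `F : ℝ → ℝ` is a smooth lift of the self-map `f` of the circle along the exponential. -/
structure IsLift (F : ℝ → ℝ) (f : Circle → Circle) : Prop where
  contDiff : ContDiff ℝ ∞ F
  map_exp : ∀ t, f (Circle.exp t) = Circle.exp (F t)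

theorem contDiff_comp_exp {f : Circle → Circle} (hf : ContMDiff (𝓡 1) (𝓡 1) ∞ f) :
    ContDiff ℝ ∞ (fun t : ℝ => (f (Circle.exp t) : ℂ)) :=
  (contMDiff_circle_coe.comp (hf.comp contMDiff_circleExp)).contDiff

theorem contDiff_deriv_of_contDiff {E : Type*} [NormedAddCommGroup E] [NormedSpace ℝ E]
    {F : ℝ → E} (hF : ContDiff ℝ ∞ F) : ContDiff ℝ ∞ (deriv F) :=
  (contDiff_infty_iff_deriv.1 hF).2

theorem hasDerivAt_of_contDiff {E : Type*} [NormedAddCommGroup E] [NormedSpace ℝ E]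
    {F : ℝ → E} (hF : ContDiff ℝ ∞ F) (t : ℝ) : HasDerivAt F (deriv F t) t :=
  (hF.differentiable (by simp) t).hasDerivAt

theorem hasDerivAt_circle_exp_comp {F : ℝ → ℝ} {F' t : ℝ} (hF : HasDerivAt F F' t) :
    HasDerivAt (fun t => (Circle.exp (F t) : ℂ)) (F' * Complex.I * Circle.exp (F t)) t := by
  simp only [Circle.coe_exp]
  convert (hF.ofReal_comp.mul_const Complex.I).cexp using 1
  ring

/-- Every smooth self-map of the circle has a smooth lift. -/
theorem exists_isLift {f : Circle → Circle} (hf : ContMDiff (𝓡 1) (𝓡 1) ∞ f) :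
    ∃ F, IsLift F f := by
  set c : ℝ → ℂ := fun t => (f (Circle.exp t) : ℂ) with hc
  have hcs : ContDiff ℝ ∞ c := contDiff_comp_exp hf
  have hnorm : ∀ t, c t * (starRingEnd ℂ) (c t) = 1 := fun t => by
    rw [Complex.mul_conj, Circle.normSq_coe]; simp
  -- `φ` is the angular velocity: `|c| = 1` makes `c' * conj c` purely imaginary, so `c' = iφc`, and
  -- the lift is a primitive of `φ`.
  set φ : ℝ → ℝ := fun t => (deriv c t * (starRingEnd ℂ) (c t)).im with hφ
  have hdc := contDiff_deriv_of_contDiff hcs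
  have hconj : ContDiff ℝ ∞ (fun t => (starRingEnd ℂ) (c t)) := Complex.conjCLE.contDiff.comp hcs
  have hφs : ContDiff ℝ ∞ φ := Complex.imCLM.contDiff.comp (hdc.mul hconj)
  have hre : ∀ t, deriv c t = φ t * Complex.I * c t := by
    intro t
    have h1 : HasDerivAt (fun t => c t * (starRingEnd ℂ) (c t))
        (deriv c t * (starRingEnd ℂ) (c t) + c t * (starRingEnd ℂ) (deriv c t)) t :=
      (hasDerivAt_of_contDiff hcs t).mul (hasDerivAt_of_contDiff hcs t).star
    have h2 : HasDerivAt (fun t => c t * (starRingEnd ℂ) (c t)) 0 t := by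
      simp only [hnorm]; exact hasDerivAt_const _ _
    have h3 := h1.unique h2
    have h4 : (deriv c t * (starRingEnd ℂ) (c t)).re = 0 := by
      have := congrArg Complex.re h3
      simp at this ⊢
      linarith
    have h5 : deriv c t * (starRingEnd ℂ) (c t) = φ t * Complex.I := by
      apply Complex.ext
      · simpa using h4
      · simp [hφ]
    calc deriv c t = deriv c t * (c t * (starRingEnd ℂ) (c t)) := by rw [hnorm, mul_one]
      _ = deriv c t * (starRingEnd ℂ) (c t) * c t := by ring
      _ = _ := by rw [h5]
  set F : ℝ → ℝ := fun t => Complex.arg (c 0) + ∫ s in (0 : ℝ)..t, φ s with hF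
  have hFd : ∀ t, HasDerivAt F (φ t) t := fun t =>
    (intervalIntegral.integral_hasDerivAt_right (hφs.continuous.intervalIntegrable _ _)
      (hφs.continuous.stronglyMeasurableAtFilter _ _) hφs.continuous.continuousAt).const_add _
  have hFs : ContDiff ℝ ∞ F := by
    refine contDiff_infty_iff_deriv.2 ⟨fun t => (hFd t).differentiableAt, ?_⟩
    rwa [show deriv F = φ from funext fun t => (hFd t).deriv]
  refine ⟨F, hFs, fun t => ?_⟩
  have hconst : ∀ t, HasDerivAt (fun t => c t * (Circle.exp (-F t) : ℂ)) 0 t := by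
    intro t
    have := (hasDerivAt_of_contDiff hcs t).mul (hasDerivAt_circle_exp_comp (hFd t).neg)
    have e : deriv c t * (Circle.exp ((-F) t) : ℂ) + c t *
        (((-φ t : ℝ) : ℂ) * Complex.I * (Circle.exp ((-F) t) : ℂ)) = 0 := by
      rw [hre]; push_cast; ring
    rw [e] at this
    exact this
  have h0 : c t * (Circle.exp (-F t) : ℂ) = c 0 * (Circle.exp (-F 0) : ℂ) :=
    is_const_of_deriv_eq_zero (fun t => (hconst t).differentiableAt) (fun t => (hconst t).deriv) t 0
  have hF0 : Circle.exp (F 0) = f (Circle.exp 0) := by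
    simp only [hF, intervalIntegral.integral_same, add_zero, hc]
    exact Circle.exp_arg _
  have h1 : f (Circle.exp t) * Circle.exp (-F t) = f (Circle.exp 0) * Circle.exp (-F 0) :=
    Circle.ext (by simpa [hc] using h0)
  rw [← hF0, ← Circle.exp_add, add_neg_cancel, Circle.exp_zero, Circle.exp_neg] at h1
  exact mul_inv_eq_one.1 h1

theorem exists_isLift_smoothMap (f : SmoothMap) : ∃ F, IsLift F f := exists_isLift f.contMDiff

namespace IsLift

variable {F G : ℝ → ℝ} {f g : Circle → Circle}

theorem hasDerivAt (hF : IsLift F f) (t : ℝ) : HasDerivAt F (deriv F t) t :=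
  hasDerivAt_of_contDiff hF.contDiff t

theorem comp (hG : IsLift G g) (hF : IsLift F f) : IsLift (G ∘ F) (g ∘ f) :=
  ⟨hG.contDiff.comp hF.contDiff, fun t => by simp [hF.map_exp, hG.map_exp]⟩

theorem id : IsLift (fun t => t) (fun x => x) := ⟨contDiff_id, fun _ => rfl⟩

theorem add_int (hF : IsLift F f) (n : ℤ) : IsLift (fun t => F t + n * (2 * Real.pi)) f :=
  ⟨hF.contDiff.add contDiff_const, fun t => by
    rw [hF.map_exp, Circle.exp_add, Circle.exp_int_mul_two_pi, mul_one]⟩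

theorem hasDerivAt_coe (hF : IsLift F f) (t : ℝ) :
    HasDerivAt (fun t => (f (Circle.exp t) : ℂ)) (deriv F t * Complex.I * f (Circle.exp t)) t := by
  simp only [hF.map_exp]
  exact hasDerivAt_circle_exp_comp (hF.hasDerivAt t)

/-- The derivative of a lift is the angular velocity of the plane curve, which sees neither the
choice of lift nor that of the angle. -/
theorem deriv_eq_of_isLift (hF : IsLift F f) (hG : IsLift G f) (s t : ℝ)
    (h : Circle.exp s = Circle.exp t) : deriv F s = deriv G t := by
  obtain ⟨m, rfl⟩ := Circle.exp_eq_exp.1 h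
  have h1 : HasDerivAt (fun t => (f (Circle.exp t) : ℂ))
      (deriv F (t + m * (2 * Real.pi)) * Complex.I * f (Circle.exp t)) t := by
    have := (hF.hasDerivAt_coe (t + m * (2 * Real.pi))).comp_add_const t (m * (2 * Real.pi))
    simpa only [Circle.exp_add, Circle.exp_int_mul_two_pi, mul_one] using this
  have h2 := h1.unique (hG.hasDerivAt_coe t)
  have h3 := mul_right_cancel₀ (Circle.coe_ne_zero _) h2
  exact_mod_cast mul_right_cancel₀ Complex.I_ne_zero h3

/-- Two lifts of the same map differ by an integral multiple of the period. -/
theorem exists_int_eq (hF : IsLift F f) (hG : IsLift G f) :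
    ∃ n : ℤ, ∀ t, F t = G t + n * (2 * Real.pi) := by
  have h1 : ∀ t, HasDerivAt (fun t => F t - G t) 0 t := fun t => by
    have := (hF.hasDerivAt t).sub (hG.hasDerivAt t)
    rwa [hF.deriv_eq_of_isLift hG t t rfl, sub_self] at this
  obtain ⟨n, hn⟩ := Circle.exp_eq_exp.1 ((hF.map_exp 0).symm.trans (hG.map_exp 0))
  refine ⟨n, fun t => ?_⟩
  have := is_const_of_deriv_eq_zero (fun t => (h1 t).differentiableAt) (fun t => (h1 t).deriv) t 0
  linarith

/-- A lift of a circle map has a degree. -/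
theorem exists_degree (hF : IsLift F f) :
    ∃ d : ℤ, ∀ t, F (t + 2 * Real.pi) = F t + d * (2 * Real.pi) := by
  have h : IsLift (fun t => F (t + 2 * Real.pi)) f :=
    ⟨hF.contDiff.comp (contDiff_id.add contDiff_const), fun t => by
      rw [← hF.map_exp, Circle.exp_add_two_pi]⟩
  exact h.exists_int_eq hF

end IsLift

theorem map_add_int_mul {F : ℝ → ℝ} {p q : ℝ} (h : ∀ t, F (t + p) = F t + q) (n : ℤ) (t : ℝ) :
    F (t + n * p) = F t + n * q := by
  induction n using Int.induction_on with
  | zero => simp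
  | succ n ih => push_cast at ih ⊢; rw [add_mul, one_mul, ← add_assoc, h, ih]; ring
  | pred n ih =>
    push_cast at ih ⊢
    have := h (t + (-n - 1) * p)
    rw [show t + (-n - 1) * p + p = t + -n * p by ring, ih] at this
    linarith

/-- A smooth equivariant function on the line descends to a smooth map of the circle. -/
theorem exists_smoothMap_of_equivariant {F : ℝ → ℝ} (hF : ContDiff ℝ ∞ F) (d : ℤ)
    (h : ∀ t, F (t + 2 * Real.pi) = F t + d * (2 * Real.pi)) :
    ∃ f : SmoothMap, IsLift F f := by
  have key : ∀ t, Circle.exp (F (Complex.arg (Circle.exp t))) = Circle.exp (F t) := by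
    intro t
    obtain ⟨m, hm⟩ := Circle.exp_eq_exp.1 (Circle.exp_arg (Circle.exp t))
    rw [hm, map_add_int_mul h, Circle.exp_add, ← mul_assoc, ← Int.cast_mul,
      Circle.exp_int_mul_two_pi, mul_one]
  refine ⟨⟨fun z => Circle.exp (F (Complex.arg z)), contMDiff_of_comp_exp ?_⟩, hF, key⟩
  simp only [key]
  exact contMDiff_circleExp.comp hF.contMDiff

/-- One direction differentiates the plane curve, whose velocity is `F'` times a nonvanishing
factor; the other writes `f` as `Circle.exp ∘ F ∘ s` with a local smooth angle `s`. -/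
theorem IsLift.mem_singularSet_iff {f : SmoothMap} {F : ℝ → ℝ} (hF : IsLift F f) (t : ℝ) :
    Circle.exp t ∈ singularSet f ↔ deriv F t = 0 := by
  have hfd : ∀ x, MDifferentiableAt (𝓡 1) (𝓡 1) f x := fun x =>
    f.contMDiff.mdifferentiableAt (by simp)
  have hcd : ∀ x, MDifferentiableAt (𝓡 1) 𝓘(ℝ, ℂ) (fun z : Circle => (z : ℂ)) x := fun x =>
    contMDiff_circle_coe.mdifferentiableAt (by simp)
  have hed : ∀ t, MDifferentiableAt 𝓘(ℝ, ℝ) (𝓡 1) Circle.exp t := fun x =>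
    (contMDiff_circleExp (m := ∞)).mdifferentiableAt (by simp)
  constructor
  · intro h
    have h1 : mfderiv (𝓡 1) (𝓡 1) f (Circle.exp t) = 0 := h
    have h2 : mfderiv 𝓘(ℝ, ℝ) 𝓘(ℝ, ℂ) ((fun z : Circle => (z : ℂ)) ∘ f ∘ Circle.exp) t = 0 := by
      rw [mfderiv_comp t (hcd _) ((hfd _).comp t (hed t)), mfderiv_comp t (hfd _) (hed t), h1]
      ext; simp
    rw [mfderiv_eq_fderiv] at h2
    have h3 : deriv ((fun z : Circle => (z : ℂ)) ∘ f ∘ Circle.exp) t = 0 := by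
      rw [← fderiv_apply_one_eq_deriv, h2]; rfl
    have h4 := (hF.hasDerivAt_coe t).deriv.symm.trans h3
    simpa using h4
  · intro h
    obtain ⟨s, hs, hsx⟩ := exists_smooth_angle (Circle.exp t)
    have hsd := hs.mdifferentiableAt (by simp)
    have h1 : (f : Circle → Circle) = Circle.exp ∘ F ∘ s := by
      funext z; simp only [Function.comp_apply, ← hF.map_exp, hsx]
    have h2 : mfderiv 𝓘(ℝ, ℝ) 𝓘(ℝ, ℝ) F (s (Circle.exp t)) = 0 := by
      rw [mfderiv_eq_fderiv]
      have : deriv F (s (Circle.exp t)) = 0 := by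
        rw [hF.deriv_eq_of_isLift hF _ t (hsx _), h]
      refine ContinuousLinearMap.ext_ring ?_
      exact (fderiv_apply_one_eq_deriv (𝕜 := ℝ)).trans this
    have hFd : MDifferentiableAt 𝓘(ℝ, ℝ) 𝓘(ℝ, ℝ) F (s (Circle.exp t)) :=
      (hF.hasDerivAt _).differentiableAt.mdifferentiableAt
    change mfderiv (𝓡 1) (𝓡 1) f (Circle.exp t) = 0
    rw [h1, mfderiv_comp _ (hed _) (hFd.comp _ hsd), mfderiv_comp _ hFd hsd, h2]
    ext; simp

/-! ### Equivariant diffeomorphisms of the line -/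

/-- `H` is a diffeomorphism of the line with inverse `Hi` that descends to a diffeomorphism of the
circle of degree `e`. -/
structure IsEquivariantDiffeo (H Hi : ℝ → ℝ) (e : ℤ) : Prop where
  contDiff : ContDiff ℝ ∞ H
  contDiff_inv : ContDiff ℝ ∞ Hi
  left_inv : ∀ t, Hi (H t) = t
  right_inv : ∀ t, H (Hi t) = t
  sign : e = 1 ∨ e = -1
  add_period : ∀ t, H (t + 2 * Real.pi) = H t + e * (2 * Real.pi)

namespace IsEquivariantDiffeo

variable {H Hi K Ki : ℝ → ℝ} {e e' : ℤ}

theorem mul_self (h : IsEquivariantDiffeo H Hi e) : e * e = 1 := by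
  rcases h.sign with rfl | rfl <;> norm_num

theorem symm (h : IsEquivariantDiffeo H Hi e) : IsEquivariantDiffeo Hi H e := by
  refine ⟨h.contDiff_inv, h.contDiff, h.right_inv, h.left_inv, h.sign, fun t => ?_⟩
  have h1 := map_add_int_mul h.add_period e (Hi t)
  have h2 : (e : ℝ) * (e * (2 * Real.pi)) = 2 * Real.pi := by
    rw [← mul_assoc, ← Int.cast_mul, h.mul_self, Int.cast_one, one_mul]
  rw [h.right_inv, h2] at h1
  rw [← h1, h.left_inv]

theorem neg : IsEquivariantDiffeo (fun t => -t) (fun t => -t) (-1) :=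
  ⟨contDiff_neg, contDiff_neg, neg_neg, neg_neg, Or.inr rfl, fun t => by push_cast; ring⟩

theorem add_const (h : IsEquivariantDiffeo H Hi e) (c : ℝ) :
    IsEquivariantDiffeo (fun t => H t + c) (fun t => Hi (t - c)) e :=
  ⟨h.contDiff.add contDiff_const, h.contDiff_inv.comp (contDiff_id.sub contDiff_const),
    fun t => by simp [h.left_inv], fun t => by simp [h.right_inv], h.sign,
    fun t => by rw [h.add_period]; ring⟩

theorem comp (h : IsEquivariantDiffeo H Hi e) (k : IsEquivariantDiffeo K Ki e') :
    IsEquivariantDiffeo (fun t => H (K t)) (fun t => Ki (Hi t)) (e * e') :=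
  ⟨h.contDiff.comp k.contDiff, k.contDiff_inv.comp h.contDiff_inv,
    fun t => by simp [h.left_inv, k.left_inv], fun t => by simp [h.right_inv, k.right_inv],
    by rcases h.sign with rfl | rfl <;> rcases k.sign with rfl | rfl <;> simp,
    fun t => by rw [k.add_period, map_add_int_mul h.add_period]; push_cast; ring⟩

theorem deriv_ne_zero (h : IsEquivariantDiffeo H Hi e) (t : ℝ) : deriv H t ≠ 0 := by
  intro h0
  have h1 := (hasDerivAt_of_contDiff h.contDiff_inv (H t)).comp t
    (hasDerivAt_of_contDiff h.contDiff t)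
  have h2 : Hi ∘ H = fun t => t := funext h.left_inv
  rw [h2, h0, mul_zero] at h1
  exact one_ne_zero ((hasDerivAt_id' t).unique h1)

theorem injective (h : IsEquivariantDiffeo H Hi e) : Function.Injective H :=
  Function.LeftInverse.injective h.left_inv

theorem strictMono (h : IsEquivariantDiffeo H Hi 1) : StrictMono H := by
  refine (h.contDiff.continuous.strictMono_of_inj h.injective).resolve_right fun hanti => ?_
  have h1 := hanti (show (0 : ℝ) < 0 + 2 * Real.pi by positivity)
  rw [h.add_period] at h1
  push_cast at h1
  linarith [Real.pi_pos]

/-- An equivariant diffeomorphism of the line descends to a diffeomorphism of the circle. -/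
theorem exists_diffeomorph (h : IsEquivariantDiffeo H Hi e) :
    ∃ φ : Circle ≃ₘ^∞⟮𝓡 1, 𝓡 1⟯ Circle, IsLift H φ := by
  obtain ⟨φ, hφ⟩ := exists_smoothMap_of_equivariant h.contDiff e h.add_period
  obtain ⟨ψ, hψ⟩ := exists_smoothMap_of_equivariant h.contDiff_inv e h.symm.add_period
  refine ⟨⟨⟨φ, ψ, fun x => ?_, fun x => ?_⟩, φ.contMDiff, ψ.contMDiff⟩, hφ⟩
  · rw [← Circle.exp_arg x, hφ.map_exp, hψ.map_exp, h.left_inv]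
  · rw [← Circle.exp_arg x, hψ.map_exp, hφ.map_exp, h.right_inv]

end IsEquivariantDiffeo

/-- A diffeomorphism of the circle lifts to an equivariant diffeomorphism of the line. -/
theorem exists_isEquivariantDiffeo (φ : Circle ≃ₘ^∞⟮𝓡 1, 𝓡 1⟯ Circle) :
    ∃ H Hi e, IsEquivariantDiffeo H Hi e ∧ IsLift H φ := by
  obtain ⟨H, hH⟩ := exists_isLift φ.contMDiff
  obtain ⟨K₀, hK₀⟩ := exists_isLift φ.symm.contMDiff
  have hid : IsLift (K₀ ∘ H) (fun x => x) := by
    have := hK₀.comp hH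
    rwa [show φ.symm ∘ φ = fun x => x from funext φ.symm_apply_apply] at this
  obtain ⟨n, hn⟩ := hid.exists_int_eq IsLift.id
  -- The lift of the inverse is an inverse of `H` only up to a deck translation, which is removed
  -- here.
  have hK := hK₀.add_int (-n)
  set K := fun t => K₀ t + ((-n : ℤ) : ℝ) * (2 * Real.pi) with hKdef
  have hKH : ∀ t, K (H t) = t := fun t => by
    have := hn t
    simp only [Function.comp_apply] at this
    simp only [hKdef, this]; push_cast; ring
  have hid' : IsLift (H ∘ K) (fun x => x) := by
    have := hH.comp hK
    rwa [show φ ∘ φ.symm = fun x => x from funext φ.apply_symm_apply] at this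
  obtain ⟨m, hm⟩ := hid'.exists_int_eq IsLift.id
  have hm0 : (m : ℝ) * (2 * Real.pi) = 0 := by
    have h1 := hm (H 0)
    simp only [Function.comp_apply, hKH] at h1
    linarith
  have hHK : ∀ t, H (K t) = t := fun t => by
    have := hm t
    rwa [hm0, add_zero] at this
  obtain ⟨d, hd⟩ := hH.exists_degree
  obtain ⟨d', hd'⟩ := hK.exists_degree
  have hdd : d' * d = 1 := by
    have h1 := hKH (0 + 2 * Real.pi)
    rw [hd, map_add_int_mul hd', hKH] at h1
    have h2 : ((d' * d : ℤ) : ℝ) * (2 * Real.pi) = 1 * (2 * Real.pi) := by push_cast; linarith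
    exact_mod_cast mul_right_cancel₀ (by positivity) h2
  exact ⟨H, K, d, ⟨hH.contDiff, hK.contDiff, hKH, hHK,
    Int.isUnit_iff.1 (IsUnit.of_mul_eq_one_right _ hdd), hd⟩, hH⟩

/-- Smooth equivalence of circle maps in terms of their lifts. -/
theorem smoothEquiv_iff {f g : SmoothMap} {F G : ℝ → ℝ} (hF : IsLift F f) (hG : IsLift G g) :
    SmoothEquiv f g ↔ ∃ H Hi K Ki : ℝ → ℝ, ∃ e e' : ℤ,
      IsEquivariantDiffeo H Hi e ∧ IsEquivariantDiffeo K Ki e' ∧ ∀ t, K (F t) = G (H t) := by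
  constructor
  · rintro ⟨h, k, hk⟩
    obtain ⟨H, Hi, e, hH, hHl⟩ := exists_isEquivariantDiffeo h
    obtain ⟨K, Ki, e', hK, hKl⟩ := exists_isEquivariantDiffeo k
    have h1 := hKl.comp hF
    rw [show (k ∘ f : Circle → Circle) = g ∘ h from funext hk] at h1
    obtain ⟨n, hn⟩ := (hG.comp hHl).exists_int_eq h1
    -- The two lifts of `k ∘ f = g ∘ h` differ by a deck translation, which is absorbed into `K`.
    exact ⟨H, Hi, _, _, e, e', hH, hK.add_const (n * (2 * Real.pi)), fun t => (hn t).symm⟩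
  · rintro ⟨H, Hi, K, Ki, e, e', hH, hK, heq⟩
    obtain ⟨h, hh⟩ := hH.exists_diffeomorph
    obtain ⟨k, hk⟩ := hK.exists_diffeomorph
    refine ⟨h, k, fun x => ?_⟩
    rw [← Circle.exp_arg x, hF.map_exp, hk.map_exp, hh.map_exp, hG.map_exp, heq]

/-! ### Density of maps with simple folds -/

theorem exists_contDiff_iteratedDeriv {E V : Type*} [NormedAddCommGroup E] [NormedSpace ℝ E]
    [NormedAddCommGroup V] [NormedSpace ℝ V] {Ψ : E × ℝ → V} (hΨ : ContDiff ℝ ∞ Ψ) (k : ℕ) :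
    ∃ Ψk : E × ℝ → V, ContDiff ℝ ∞ Ψk ∧
      ∀ e t, iteratedDeriv k (fun t => Ψ (e, t)) t = Ψk (e, t) := by
  induction k with
  | zero => exact ⟨Ψ, hΨ, fun e t => by simp⟩
  | succ k ih =>
    obtain ⟨Ψk, hk, hk'⟩ := ih
    refine ⟨fun p => fderiv ℝ Ψk p (0, 1),
      (contDiff_infty_iff_fderiv.1 hk).2.clm_apply contDiff_const, fun e t => ?_⟩
    rw [iteratedDeriv_succ, show iteratedDeriv k (fun t => Ψ (e, t)) = fun t => Ψk (e, t) from
      funext (hk' e)]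
    have h1 : HasDerivAt (fun t : ℝ => (e, t)) ((0 : E), (1 : ℝ)) t :=
      (hasDerivAt_const t e).prodMk (hasDerivAt_id' t)
    exact ((hk.differentiable (by simp) (e, t)).hasFDerivAt.comp_hasDerivAt t h1).deriv

theorem iteratedDeriv_curve_periodic (f : SmoothMap) (k : ℕ) :
    Function.Periodic (iteratedDeriv k (curve f)) (2 * Real.pi) := by
  intro t
  have h : (fun z => curve f (z + 2 * Real.pi)) = curve f := by
    funext z; simp only [curve, Circle.exp_add_two_pi]
  have := congrFun (iteratedDeriv_comp_add_const k (curve f) (2 * Real.pi)) t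
  rw [h] at this
  exact this.symm

/-- A smooth family of circle maps is continuous in the smooth topology. -/
theorem eventually_mem_basicNhd {E : Type*} [NormedAddCommGroup E] [NormedSpace ℝ E]
    {Φ : E × ℝ → ℝ} (hΦ : ContDiff ℝ ∞ Φ) {f : SmoothMap} (hf : IsLift (fun t => Φ (0, t)) f)
    (r : ℕ) {ε : ℝ} (hε : 0 < ε) :
    ∀ᶠ e in nhds (0 : E), ∀ g : SmoothMap, IsLift (fun t => Φ (e, t)) g → g ∈ basicNhd f r ε := by
  have hΨ : ContDiff ℝ ∞ (fun p : E × ℝ => (Circle.exp (Φ p) : ℂ)) :=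
    (contMDiff_circle_coe.comp contMDiff_circleExp).contDiff.comp hΦ
  have key : ∀ k ∈ Finset.range (r + 1), ∀ᶠ e in nhds (0 : E), ∀ g : SmoothMap,
      IsLift (fun t => Φ (e, t)) g →
        ∀ t, ‖iteratedDeriv k (curve g) t - iteratedDeriv k (curve f) t‖ < ε := by
    intro k _
    obtain ⟨Ψ, hs, hd⟩ := exists_contDiff_iteratedDeriv hΨ k
    have hcurve : ∀ (e : E) (g : SmoothMap), IsLift (fun t => Φ (e, t)) g →
        ∀ t, iteratedDeriv k (curve g) t = Ψ (e, t) := fun e g hg t => by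
      rw [← hd, show curve g = fun t => (Circle.exp (Φ (e, t)) : ℂ) from
        funext fun t => congrArg _ (hg.map_exp t)]
    -- Joint continuity is uniform over one compact period; periodicity of the derivatives extends
    -- the bound to all angles.
    have h1 : ∀ᶠ e in nhds (0 : E), ∀ t ∈ Set.Icc (0 : ℝ) (2 * Real.pi),
        ‖Ψ (e, t) - Ψ (0, t)‖ < ε := by
      refine isCompact_Icc.eventually_forall_of_forall_eventually fun t _ => ?_
      have hc : Continuous (fun p : E × ℝ => ‖Ψ (p.1, p.2) - Ψ (0, p.2)‖) := by
        have := hs.continuous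
        fun_prop
      exact hc.continuousAt.eventually_lt continuousAt_const (by simpa using hε)
    filter_upwards [h1] with e he g hg t
    have hper : Function.Periodic
        (fun t => iteratedDeriv k (curve g) t - iteratedDeriv k (curve f) t) (2 * Real.pi) :=
      (iteratedDeriv_curve_periodic g k).sub (iteratedDeriv_curve_periodic f k)
    obtain ⟨y, hy, hty⟩ := hper.exists_mem_Ico₀ Real.two_pi_pos t
    rw [hty, hcurve e g hg, hcurve 0 f hf]
    exact he y (Set.Ico_subset_Icc_self hy)
  filter_upwards [(Filter.eventually_all_finset _).2 key] with e he g hg k hk t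
  exact he k (Finset.mem_range.2 (by omega)) g hg t

/-- All critical points of `F` are nondegenerate. -/
def IsMorse (F : ℝ → ℝ) : Prop := ∀ t, deriv F t = 0 → deriv (deriv F) t ≠ 0

/-- Perturb the lift by `a cos t + b sin t`. A degenerate critical point at `t` imposes two
independent linear equations on `(a, b)`, with unique solution `c t`. The bad parameters thus lie on
a `C^1` curve in the plane, whose complement is dense. -/
theorem exists_isMorse_mem_basicNhd (f : SmoothMap) (r : ℕ) {ε : ℝ} (hε : 0 < ε) :
    ∃ (g : SmoothMap) (G : ℝ → ℝ), IsLift G g ∧ g ∈ basicNhd f r ε ∧ IsMorse G := by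
  obtain ⟨F, hF⟩ := exists_isLift_smoothMap f
  obtain ⟨d, hd⟩ := hF.exists_degree
  have hF1 := contDiff_deriv_of_contDiff hF.contDiff
  have hF2 := contDiff_deriv_of_contDiff hF1
  set Φ : (ℝ × ℝ) × ℝ → ℝ := fun p => F p.2 + (p.1.1 * Real.cos p.2 + p.1.2 * Real.sin p.2) with hΦ
  have hΦs : ContDiff ℝ ∞ Φ := by
    have h := hF.contDiff
    have h1 : ContDiff ℝ ∞ Real.cos := Real.contDiff_cos
    have h2 : ContDiff ℝ ∞ Real.sin := Real.contDiff_sin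
    fun_prop
  have hev := eventually_mem_basicNhd hΦs (f := f) (by simpa [hΦ] using hF) r hε
  set c : ℝ → ℝ × ℝ := fun t => (deriv F t * Real.sin t + deriv (deriv F) t * Real.cos t,
    -deriv F t * Real.cos t + deriv (deriv F) t * Real.sin t) with hc
  have hcs : ContDiff ℝ 1 c := by
    have h1 : ContDiff ℝ 1 (deriv F) := hF1.of_le (by simp)
    have h2 : ContDiff ℝ 1 (deriv (deriv F)) := hF2.of_le (by simp)
    have h3 : ContDiff ℝ 1 Real.cos := Real.contDiff_cos
    have h4 : ContDiff ℝ 1 Real.sin := Real.contDiff_sin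
    fun_prop
  have hdense := hcs.dense_compl_range_of_finrank_lt_finrank (by simp)
  obtain ⟨⟨a, b⟩, hab, hmem⟩ :=
    ((mem_closure_iff_frequently.1 (hdense 0)).and_eventually hev).exists
  have hG : ContDiff ℝ ∞ (fun t => Φ ((a, b), t)) := hΦs.comp (contDiff_const.prodMk contDiff_id)
  obtain ⟨g, hg⟩ := exists_smoothMap_of_equivariant hG d (fun t => by
    simp only [hΦ, hd, Real.cos_add_two_pi, Real.sin_add_two_pi]; ring)
  refine ⟨g, _, hg, hmem g hg, fun t ht ht2 => hab ⟨t, ?_⟩⟩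
  have d1 : ∀ t, HasDerivAt (fun t => Φ ((a, b), t))
      (deriv F t + (a * -Real.sin t + b * Real.cos t)) t := fun t =>
    (hF.hasDerivAt t).add (((Real.hasDerivAt_cos t).const_mul a).add
      ((Real.hasDerivAt_sin t).const_mul b))
  have d2 : ∀ t, HasDerivAt (fun t => deriv F t + (a * -Real.sin t + b * Real.cos t))
      (deriv (deriv F) t + (a * -Real.cos t + b * -Real.sin t)) t := fun t =>
    (hasDerivAt_of_contDiff hF1 t).add ((((Real.hasDerivAt_sin t).neg).const_mul a).add
      ((Real.hasDerivAt_cos t).const_mul b))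
  rw [show deriv (fun t => Φ ((a, b), t)) = _ from funext fun t => (d1 t).deriv] at ht ht2
  rw [(d2 t).deriv] at ht2
  have hcs := Real.sin_sq_add_cos_sq t
  simp only [hc, Prod.mk.injEq]
  constructor
  · linear_combination Real.sin t * ht + Real.cos t * ht2 + a * hcs
  · linear_combination (-Real.cos t) * ht + Real.sin t * ht2 + b * hcs

/-- An infinite subset of a compact set would accumulate somewhere in it. -/
theorem finite_of_forall_eventually_ne {K : Set ℝ} (hK : IsCompact K) {P : ℝ → Prop}
    (h : ∀ x ∈ K, ∀ᶠ y in nhdsWithin x {x}ᶜ, ¬ P y) : {x | x ∈ K ∧ P x}.Finite := by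
  by_contra hinf
  obtain ⟨x, hx, hacc⟩ :=
    Set.Infinite.exists_accPt_of_subset_isCompact hinf hK (fun y hy => hy.1)
  obtain ⟨y, ⟨hyx, -, hy⟩, hy'⟩ :=
    ((accPt_iff_frequently.1 hacc).and_eventually (eventually_nhdsWithin_iff.1 (h x hx))).exists
  exact hy' hyx hy

theorem IsMorse.eventually_deriv_ne {F : ℝ → ℝ} (hs : ContDiff ℝ ∞ F) (hF : IsMorse F) (x : ℝ) :
    ∀ᶠ y in nhdsWithin x {x}ᶜ, deriv F y ≠ 0 := by
  have hd := hasDerivAt_of_contDiff (contDiff_deriv_of_contDiff hs) x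
  by_cases h : deriv F x = 0
  · exact hd.eventually_ne (hF x h)
  · exact (hd.continuousAt.eventually_ne h).filter_mono nhdsWithin_le_nhds

theorem finite_singularSet {f : SmoothMap} {F : ℝ → ℝ} (hf : IsLift F f) (hF : IsMorse F) :
    (singularSet f).Finite := by
  have h := finite_of_forall_eventually_ne (K := Set.Icc (-Real.pi) Real.pi) isCompact_Icc
    (P := fun x => deriv F x = 0) (fun x _ => hF.eventually_deriv_ne hf.contDiff x)
  refine (h.image Circle.exp).subset fun x hx => ⟨Complex.arg x, ⟨⟨?_, ?_⟩, ?_⟩, Circle.exp_arg x⟩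
  · exact (Complex.neg_pi_lt_arg _).le
  · exact Complex.arg_le_pi _
  · exact (hf.mem_singularSet_iff _).1 (by rwa [Circle.exp_arg])

/-- Given values at finitely many points of the circle are attained by a smooth function which is
locally constant near these points. -/
theorem exists_smooth_locally_const {S : Set Circle} (hS : S.Finite) (c : Circle → ℝ) :
    ∃ u : Circle → ℝ, ContMDiff (𝓡 1) 𝓘(ℝ, ℝ) ∞ u ∧ ∀ s ∈ S, ∀ᶠ x in nhds s, u x = c s := by
  obtain ⟨U, hU, hdisj⟩ := hS.t2_separation
  have hV : ∀ s, ∃ V ∈ nhds s, IsClosed V ∧ V ⊆ U s := fun s =>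
    exists_mem_nhds_isClosed_subset ((hU s).2.mem_nhds (hU s).1)
  choose V hVn hVc hVU using hV
  obtain ⟨u, hu⟩ := exists_contMDiffMap_forall_mem_convex_of_local_const (𝓡 1) (n := ⊤)
    (t := fun x : Circle => {y : ℝ | ∀ s ∈ S, x ∈ V s → y = c s})
    (fun x => by
      intro y hy z hz a b _ _ hab s hs hx
      rw [hy s hs hx, hz s hs hx, ← add_smul, hab, one_smul])
    (fun x => by
      by_cases h : ∃ s ∈ S, x ∈ U s
      · obtain ⟨s, hs, hx⟩ := h
        refine ⟨c s, ?_⟩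
        filter_upwards [(hU s).2.mem_nhds hx] with y hy s' hs' hy'
        by_contra hne
        exact Set.disjoint_left.1 (hdisj hs hs' fun e => hne (by rw [e])) hy (hVU s' hy')
      · push Not at h
        refine ⟨0, ?_⟩
        have hcl := hS.isClosed_biUnion (f := V) fun s _ => hVc s
        filter_upwards [hcl.isOpen_compl.mem_nhds (show x ∈ (⋃ s ∈ S, V s)ᶜ by
          simp only [Set.mem_compl_iff, Set.mem_iUnion, not_exists]
          exact fun s hs hx => h s hs (hVU s hx))] with y hy s hs hys
        exact absurd (Set.mem_biUnion hs hys) hy)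
  exact ⟨u, u.contMDiff, fun s hs => by
    filter_upwards [hVn s] with x hx using hu x s hs hx⟩

/-- The generic property of circle maps: all singular points are folds, and different singular
points have different values. -/
structure HasSimpleFolds (f : SmoothMap) : Prop where
  isMorse : ∀ F, IsLift F f → IsMorse F
  injOn : Set.InjOn f (singularSet f)

theorem IsMorse.of_isLift {f : SmoothMap} {F G : ℝ → ℝ} (hF : IsLift F f) (hG : IsLift G f)
    (h : IsMorse F) : IsMorse G := by
  have : deriv G = deriv F := funext fun t => hG.deriv_eq_of_isLift hF t t rfl
  intro t
  rw [this]
  exact h t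

/-- Add `δ * u`, where `u` is constant near each critical point, with the argument of that point as
value. Near critical points only the values change, and distinct points receive distinct multiples
of `δ`, so critical values are separated for small `δ` outside a countable set. -/
theorem exists_hasSimpleFolds_of_isMorse {f : SmoothMap} {F : ℝ → ℝ} (hf : IsLift F f)
    (hF : IsMorse F) (r : ℕ) {ε : ℝ} (hε : 0 < ε) :
    ∃ g ∈ basicNhd f r ε, HasSimpleFolds g := by
  obtain ⟨d, hd⟩ := hf.exists_degree
  have hS := finite_singularSet hf hF
  obtain ⟨u, hus, hu⟩ := exists_smooth_locally_const hS (fun x => Complex.arg (x : ℂ))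
  set U : ℝ → ℝ := fun t => u (Circle.exp t) with hU
  have hUs : ContDiff ℝ ∞ U := (hus.comp contMDiff_circleExp).contDiff
  have hU1 := contDiff_deriv_of_contDiff hUs
  have hF1 := contDiff_deriv_of_contDiff hf.contDiff
  have hUloc : ∀ t, deriv F t = 0 → ∀ᶠ y in nhds t, deriv U y = 0 := by
    intro t ht
    have h1 : ∀ᶠ y in nhds t, U y = Complex.arg (Circle.exp t : ℂ) :=
      Circle.exp.continuous.continuousAt.eventually (hu _ ((hf.mem_singularSet_iff t).2 ht))
    filter_upwards [h1.eventually_nhds] with y hy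
    have := Filter.EventuallyEq.deriv_eq (f := fun _ => Complex.arg (Circle.exp t : ℂ)) hy
    rw [this, deriv_const]
  set Φ : ℝ × ℝ → ℝ := fun p => F p.2 + p.1 * U p.2 with hΦ
  have hΦs : ContDiff ℝ ∞ Φ := by
    have h := hf.contDiff
    fun_prop
  have hev := eventually_mem_basicNhd hΦs (f := f) (by simpa [hΦ] using hf) r hε
  -- No new critical points appear for small `δ`: near old ones `U' = 0`, and elsewhere `F' ≠ 0`
  -- survives by compactness.
  have hcrit : ∀ᶠ δ in nhds (0 : ℝ), ∀ t ∈ Set.Icc (-Real.pi) Real.pi,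
      deriv F t + δ * deriv U t = 0 → deriv F t = 0 := by
    refine isCompact_Icc.eventually_forall_of_forall_eventually fun t _ => ?_
    by_cases ht : deriv F t = 0
    · have := (continuous_snd.tendsto ((0 : ℝ), t)).eventually (hUloc t ht)
      filter_upwards [this] with p hp h
      rwa [hp, mul_zero, add_zero] at h
    · have hc : Continuous (fun p : ℝ × ℝ => deriv F p.2 + p.1 * deriv U p.2) := by
        have h1 := hF1.continuous
        have h2 := hU1.continuous
        fun_prop
      filter_upwards [hc.continuousAt.eventually_ne (y := 0) (x := ((0 : ℝ), t)) (by simpa using ht)]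
        with p hp h
      exact absurd h hp
  -- The bad `δ`: for each pair `s ≠ t` and each `n` the condition is affine in `δ` with nonzero
  -- slope, hence has at most one solution.
  set B : Set ℝ := ⋃ s ∈ singularSet f, ⋃ t ∈ singularSet f, ⋃ n : ℤ,
    {δ | s ≠ t ∧ F (Complex.arg s) - F (Complex.arg t) +
      δ * (Complex.arg (s : ℂ) - Complex.arg (t : ℂ)) = n * (2 * Real.pi)} with hB
  have hBc : B.Countable := by
    refine hS.countable.biUnion fun s _ => hS.countable.biUnion fun t _ =>
      Set.countable_iUnion fun n => Set.Subsingleton.countable ?_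
    rintro x ⟨hst, hx⟩ y ⟨-, hy⟩
    have hne : Complex.arg (s : ℂ) - Complex.arg (t : ℂ) ≠ 0 :=
      sub_ne_zero.2 fun h => hst (Circle.injective_arg h)
    exact mul_right_cancel₀ hne (by linarith)
  obtain ⟨δ, hδB, hδ, hδc⟩ := ((mem_closure_iff_frequently.1
    (hBc.dense_compl ℝ 0)).and_eventually (hev.and hcrit)).exists
  have hG : ContDiff ℝ ∞ (fun t => Φ (δ, t)) := hΦs.comp (contDiff_const.prodMk contDiff_id)
  obtain ⟨g, hg⟩ := exists_smoothMap_of_equivariant hG d (fun t => by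
    simp only [hΦ, hd, hU, Circle.exp_add_two_pi]; ring)
  have d1 : ∀ t, HasDerivAt (fun t => Φ (δ, t)) (deriv F t + δ * deriv U t) t := fun t =>
    (hf.hasDerivAt t).add ((hasDerivAt_of_contDiff hUs t).const_mul δ)
  have hd1 : deriv (fun t => Φ (δ, t)) = fun t => deriv F t + δ * deriv U t :=
    funext fun t => (d1 t).deriv
  have hsub : singularSet g ⊆ singularSet f := by
    intro x hx
    rw [← Circle.exp_arg x, hg.mem_singularSet_iff, hd1] at hx
    rw [← Circle.exp_arg x, hf.mem_singularSet_iff]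
    exact hδc _ ⟨(Complex.neg_pi_lt_arg _).le, Complex.arg_le_pi _⟩ hx
  refine ⟨g, hδ g hg, fun G hG' => IsMorse.of_isLift hg hG' fun t ht => ?_, ?_⟩
  · have htF : deriv F t = 0 :=
      (hf.mem_singularSet_iff t).1 (hsub ((hg.mem_singularSet_iff t).2 ht))
    have h2 : deriv (fun t => deriv F t + δ * deriv U t) t = deriv (deriv F) t := by
      refine Filter.EventuallyEq.deriv_eq ?_
      filter_upwards [hUloc t htF] with y hy
      rw [hy, mul_zero, add_zero]
    rw [hd1, h2]
    exact hF t htF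
  · intro x hx y hy hxy
    by_contra hne
    have hux : ∀ z ∈ singularSet g, U (Complex.arg z) = Complex.arg z := fun z hz => by
      simp only [hU, Circle.exp_arg]
      exact (hu z (hsub hz)).self_of_nhds
    rw [← Circle.exp_arg x, ← Circle.exp_arg y, hg.map_exp, hg.map_exp] at hxy
    obtain ⟨n, hn⟩ := Circle.exp_eq_exp.1 hxy
    simp only [hΦ, hux x hx, hux y hy] at hn
    refine hδB ?_
    simp only [hB, Set.mem_iUnion]
    exact ⟨x, hsub hx, y, hsub hy, n, hne, by linarith⟩

theorem exists_hasSimpleFolds_mem_basicNhd (f : SmoothMap) (r : ℕ) {ε : ℝ} (hε : 0 < ε) :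
    ∃ g ∈ basicNhd f r ε, HasSimpleFolds g := by
  obtain ⟨g, G, hG, hg, hM⟩ := exists_isMorse_mem_basicNhd f r (half_pos hε)
  obtain ⟨l, hl, hs⟩ := exists_hasSimpleFolds_of_isMorse hG hM r (half_pos hε)
  refine ⟨l, fun k hk t => ?_, hs⟩
  have h1 := hg k hk t
  have h2 := hl k hk t
  calc _ = ‖(iteratedDeriv k (curve l) t - iteratedDeriv k (curve g) t) +
        (iteratedDeriv k (curve g) t - iteratedDeriv k (curve f) t)‖ := by rw [sub_add_sub_cancel]
    _ ≤ _ := norm_add_le _ _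
    _ < ε := by linarith

/-! ### Invariance of simple folds under equivalence -/

/-- Singular points correspond to each other under an equivalence. -/
theorem mem_singularSet_iff_of_conj {f g : SmoothMap} {h k : Circle ≃ₘ^∞⟮𝓡 1, 𝓡 1⟯ Circle}
    (hk : ∀ x, k (f x) = g (h x)) (x : Circle) : x ∈ singularSet f ↔ h x ∈ singularSet g := by
  obtain ⟨F, hF⟩ := exists_isLift_smoothMap f
  obtain ⟨G, hG⟩ := exists_isLift_smoothMap g
  obtain ⟨H, Hi, e, hH, hHl⟩ := exists_isEquivariantDiffeo h
  obtain ⟨K, Ki, e', hK, hKl⟩ := exists_isEquivariantDiffeo k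
  have h1 := hKl.comp hF
  rw [show (k ∘ f : Circle → Circle) = g ∘ h from funext hk] at h1
  have h2 := h1.deriv_eq_of_isLift (hG.comp hHl) (Complex.arg x) (Complex.arg x) rfl
  rw [((hasDerivAt_of_contDiff hK.contDiff _).comp _ (hF.hasDerivAt _)).deriv,
    ((hG.hasDerivAt _).comp _ (hasDerivAt_of_contDiff hH.contDiff _)).deriv] at h2
  rw [← Circle.exp_arg x, hHl.map_exp, hF.mem_singularSet_iff, hG.mem_singularSet_iff]
  constructor
  · intro h0
    rw [h0, mul_zero] at h2
    exact (mul_eq_zero.1 h2.symm).resolve_right (hH.deriv_ne_zero _)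
  · intro h0
    rw [h0, zero_mul] at h2
    exact (mul_eq_zero.1 h2).resolve_left (hK.deriv_ne_zero _)

/-- Differentiating `K ∘ F = G ∘ H` twice at a critical point leaves `K' F'' = G'' (H')²`, so
degeneracy would pass from `F` to `G`. -/
theorem HasSimpleFolds.of_smoothEquiv {f g : SmoothMap} (h : SmoothEquiv f g)
    (hg : HasSimpleFolds g) : HasSimpleFolds f := by
  constructor
  · intro F hF
    obtain ⟨G, hG⟩ := exists_isLift_smoothMap g
    obtain ⟨H, Hi, K, Ki, e, e', hH, hK, heq⟩ := (smoothEquiv_iff hF hG).1 h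
    intro t h1 h2
    have hd : ∀ t, deriv K (F t) * deriv F t = deriv G (H t) * deriv H t := by
      intro t
      have h3 := (hasDerivAt_of_contDiff hK.contDiff _).comp t (hF.hasDerivAt t)
      have h4 := (hG.hasDerivAt _).comp t (hasDerivAt_of_contDiff hH.contDiff t)
      rw [show K ∘ F = G ∘ H from funext heq] at h3
      exact h3.unique h4
    have h3 := ((hasDerivAt_of_contDiff (contDiff_deriv_of_contDiff hK.contDiff) (F t)).comp t
      (hF.hasDerivAt t)).mul (hasDerivAt_of_contDiff (contDiff_deriv_of_contDiff hF.contDiff) t)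
    have h4 := ((hasDerivAt_of_contDiff (contDiff_deriv_of_contDiff hG.contDiff) (H t)).comp t
      (hasDerivAt_of_contDiff hH.contDiff t)).mul
        (hasDerivAt_of_contDiff (contDiff_deriv_of_contDiff hH.contDiff) t)
    have h5 : ((deriv K ∘ F) * deriv F) = ((deriv G ∘ H) * deriv H) := funext hd
    rw [h5] at h3
    have h6 := h3.unique h4
    have h7 := hd t
    rw [h1, mul_zero] at h7
    have h8 := (mul_eq_zero.1 h7.symm).resolve_right (hH.deriv_ne_zero _)
    simp only [h1, h2, Function.comp_apply, h8, mul_zero, zero_mul, add_zero] at h6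
    have h9 := hH.deriv_ne_zero t
    exact hg.isMorse G hG _ h8 (by simpa [h9] using h6)
  · obtain ⟨h, k, hk⟩ := h
    intro x hx y hy hxy
    have := hg.injOn ((mem_singularSet_iff_of_conj hk x).1 hx)
      ((mem_singularSet_iff_of_conj hk y).1 hy) (by rw [← hk, ← hk, hxy])
    exact h.injective this

/-- A stable map has simple folds. -/
theorem IsStable.hasSimpleFolds {f : SmoothMap} (hf : IsStable f) : HasSimpleFolds f := by
  obtain ⟨r, ε, hε, h⟩ := hf
  obtain ⟨g, hg, hs⟩ := exists_hasSimpleFolds_mem_basicNhd f r hε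
  exact hs.of_smoothEquiv (h g hg)

/-! ### Fold normal form and smoothness of conjugacies -/

theorem hasDerivAt_integral_of_contDiff {Φ : ℝ × ℝ → ℝ} (hΦ : ContDiff ℝ ∞ Φ) (x : ℝ) :
    HasDerivAt (fun x => ∫ s in (0 : ℝ)..1, Φ (x, s))
      (∫ s in (0 : ℝ)..1, fderiv ℝ Φ (x, s) (1, 0)) x := by
  have hd : ContDiff ℝ ∞ (fun p => fderiv ℝ Φ p (1, 0)) :=
    (contDiff_infty_iff_fderiv.1 hΦ).2.clm_apply contDiff_const
  obtain ⟨C, hC⟩ := ((isCompact_closedBall x 1).prod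
    (isCompact_Icc (a := (0 : ℝ)) (b := 1))).exists_bound_of_continuousOn hd.continuous.continuousOn
  have hc := hΦ.continuous
  have hcd := hd.continuous
  refine (intervalIntegral.hasDerivAt_integral_of_dominated_loc_of_deriv_le
    (bound := fun _ => C) (F := fun x s => Φ (x, s)) (F' := fun x s => fderiv ℝ Φ (x, s) (1, 0))
    (Metric.closedBall_mem_nhds x one_pos) ?_ ?_ ?_ ?_ ?_ ?_).2
  · exact Filter.Eventually.of_forall fun y => by
      apply Continuous.aestronglyMeasurable; fun_prop
  · apply Continuous.intervalIntegrable; fun_prop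
  · apply Continuous.aestronglyMeasurable
    exact hcd.comp (by fun_prop : Continuous fun s : ℝ => (x, s))
  · refine MeasureTheory.ae_of_all _ fun s hs y hy => hC (y, s) ⟨hy, ?_⟩
    rw [Set.uIoc_of_le zero_le_one] at hs
    exact Set.Ioc_subset_Icc_self hs
  · exact intervalIntegrable_const
  · refine MeasureTheory.ae_of_all _ fun s _ y _ => ?_
    have h1 : HasDerivAt (fun y : ℝ => (y, s)) ((1 : ℝ), (0 : ℝ)) y :=
      (hasDerivAt_id' y).prodMk (hasDerivAt_const y s)
    exact (hΦ.differentiable (by simp) (y, s)).hasFDerivAt.comp_hasDerivAt y h1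

/-- The derivative is again an integral of a smooth integrand, so induction on the order applies. -/
theorem contDiff_integral_of_contDiff {Φ : ℝ × ℝ → ℝ} (hΦ : ContDiff ℝ ∞ Φ) :
    ContDiff ℝ ∞ (fun x => ∫ s in (0 : ℝ)..1, Φ (x, s)) := by
  rw [contDiff_infty]
  intro n
  induction n generalizing Φ with
  | zero =>
    exact contDiff_zero.2 (continuous_iff_continuousAt.2 fun x =>
      (hasDerivAt_integral_of_contDiff hΦ x).continuousAt)
  | succ n ih =>
    push_cast
    rw [contDiff_succ_iff_deriv]
    refine ⟨fun x => (hasDerivAt_integral_of_contDiff hΦ x).differentiableAt, by simp, ?_⟩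
    rw [funext fun x => (hasDerivAt_integral_of_contDiff hΦ x).deriv]
    exact ih ((contDiff_infty_iff_fderiv.1 hΦ).2.clm_apply contDiff_const)

/-- Hadamard's lemma in one variable. -/
theorem exists_contDiff_eq_sub_mul {g : ℝ → ℝ} (hg : ContDiff ℝ ∞ g) {a : ℝ} (ha : g a = 0) :
    ∃ p : ℝ → ℝ, ContDiff ℝ ∞ p ∧ ∀ x, g x = (x - a) * p x := by
  have hd := contDiff_deriv_of_contDiff hg
  refine ⟨fun x => ∫ s in (0 : ℝ)..1, deriv g (a + s * (x - a)),
    contDiff_integral_of_contDiff (Φ := fun p => deriv g (a + p.2 * (p.1 - a)))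
      (hd.comp (by fun_prop)), fun x => ?_⟩
  have h1 : ∀ s : ℝ, HasDerivAt (fun s => g (a + s * (x - a)))
      (deriv g (a + s * (x - a)) * (x - a)) s := fun s => by
    have := ((hasDerivAt_id' s).mul_const (x - a)).const_add a
    rw [one_mul] at this
    exact (hasDerivAt_of_contDiff hg _).comp s this
  have h2 := intervalIntegral.integral_eq_sub_of_hasDerivAt (a := 0) (b := 1) (fun s _ => h1 s)
    (Continuous.intervalIntegrable (by have := hd.continuous; fun_prop) _ _)
  rw [intervalIntegral.integral_mul_const] at h2
  simp only [one_mul, zero_mul, add_zero, ha, sub_zero, add_sub_cancel] at h2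
  rw [← h2, mul_comm]

/-- Normal form of a nondegenerate critical point. -/
theorem exists_fold_normal_form {F : ℝ → ℝ} (hF : ContDiff ℝ ∞ F) {a : ℝ} (h1 : deriv F a = 0)
    (h2 : deriv (deriv F) a ≠ 0) :
    ∃ (σ : ℝ) (ψ : ℝ → ℝ), (σ = 1 ∨ σ = -1) ∧ ContDiffAt ℝ ∞ ψ a ∧ 0 < ψ a ∧
      ∀ᶠ t in nhds a, F t = F a + σ * ((t - a) * ψ t) ^ 2 := by
  obtain ⟨p, hp, hp'⟩ := exists_contDiff_eq_sub_mul (g := fun x => F x - F a) (a := a)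
    (hF.sub contDiff_const) (sub_self _)
  have hFp : ∀ x, HasDerivAt F (p x + (x - a) * deriv p x) x := fun x => by
    have := (((hasDerivAt_id' x).sub_const a).mul (hasDerivAt_of_contDiff hp x)).const_add (F a)
    rw [one_mul] at this
    refine this.congr_of_eventuallyEq (Filter.Eventually.of_forall fun y => ?_)
    have := hp' y
    simp only [Pi.mul_apply]
    linarith
  have hpa : p a = 0 := by
    rw [(hFp a).deriv] at h1
    simpa using h1
  obtain ⟨q, hq, hq'⟩ := exists_contDiff_eq_sub_mul hp hpa
  have hpq : HasDerivAt p (q a) a := by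
    have := ((hasDerivAt_id' a).sub_const a).mul (hasDerivAt_of_contDiff hq a)
    rw [one_mul, sub_self, zero_mul, add_zero] at this
    exact this.congr_of_eventuallyEq (Filter.Eventually.of_forall hq')
  have hqa : q a ≠ 0 := by
    intro h0
    rw [funext fun x => (hFp x).deriv] at h2
    have h3 := hpq.add (((hasDerivAt_id' a).sub_const a).mul
      (hasDerivAt_of_contDiff (contDiff_deriv_of_contDiff hp) a))
    rw [hpq.deriv, h0] at h3
    simp only [sub_self, zero_mul, mul_zero, add_zero] at h3
    exact h2 h3.deriv
  -- Two divisions give `F - F a = (t - a)² q` with `q a ≠ 0`; here `σ` is the sign of `q a` and `ψ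
  -- = √(σ q)`.
  have key : ∀ σ : ℝ, (σ = 1 ∨ σ = -1) → 0 < σ * q a → _ := fun σ hσ hpos =>
    (⟨σ, fun t => Real.sqrt (σ * q t), hσ, ?_, Real.sqrt_pos.2 hpos, ?_⟩ :
      ∃ (σ : ℝ) (ψ : ℝ → ℝ), (σ = 1 ∨ σ = -1) ∧ ContDiffAt ℝ ∞ ψ a ∧ 0 < ψ a ∧
      ∀ᶠ t in nhds a, F t = F a + σ * ((t - a) * ψ t) ^ 2)
  · rcases lt_or_gt_of_ne hqa with h | h
    · exact key (-1) (Or.inr rfl) (by linarith)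
    · exact key 1 (Or.inl rfl) (by linarith)
  · exact (Real.contDiffAt_sqrt hpos.ne').comp a (contDiffAt_const.mul hq.contDiffAt)
  · have hc : ContinuousAt (fun t => σ * q t) a := (continuous_const.mul hq.continuous).continuousAt
    filter_upwards [hc.eventually (lt_mem_nhds hpos)] with t ht
    rw [mul_pow, Real.sq_sqrt ht.le]
    have hσ2 : σ * σ = 1 := by rcases hσ with rfl | rfl <;> norm_num
    linear_combination hp' t + (t - a) * hq' t - (t - a) ^ 2 * q t * hσ2

/-- A continuous solution of `ψ ∘ H = φ` with `ψ` a local diffeomorphism is smooth. -/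
theorem contDiffAt_of_comp_eventuallyEq {H ψ φ : ℝ → ℝ} {t ψ' : ℝ} (hH : ContinuousAt H t)
    (hψ : ContDiffAt ℝ ∞ ψ (H t)) (hd : HasDerivAt ψ ψ' (H t)) (h0 : ψ' ≠ 0)
    (hφ : ContDiffAt ℝ ∞ φ t) (h : ∀ᶠ s in nhds t, ψ (H s) = φ s) : ContDiffAt ℝ ∞ H t := by
  have hd' : HasFDerivAt ψ (ContinuousLinearEquiv.unitsEquivAut ℝ (Units.mk0 ψ' h0) : ℝ →L[ℝ] ℝ)
      (H t) := by
    have e : (ContinuousLinearEquiv.unitsEquivAut ℝ (Units.mk0 ψ' h0) : ℝ →L[ℝ] ℝ) =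
        ContinuousLinearMap.toSpanSingleton ℝ ψ' := ContinuousLinearMap.ext_ring (by simp)
    rw [e]
    exact hd.hasFDerivAt
  have hn : (∞ : WithTop ℕ∞) ≠ 0 := by simp
  have hinv := hψ.to_localInverse hd' hn
  rw [h.self_of_nhds] at hinv
  have h2 := hinv.comp t hφ
  refine h2.congr_of_eventuallyEq ?_
  have hs := hψ.hasStrictFDerivAt' hd' hn
  -- Continuity of `H` keeps `H s` on the branch where the local inverse of `ψ` undoes `ψ`; so `H`
  -- is that inverse composed with `φ`.
  filter_upwards [h, hH.eventually hs.eventually_left_inverse] with s hs1 hs2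
  simp only [Function.comp_apply]
  rw [← hs1]
  exact hs2.symm

/-- In normal coordinates the conjugacy reads `σ x² = τ y²`. Monotonicity of `H` forces `x` and `y`
to have the same sign, so `y = x`, and `y` is a local diffeomorphism in `H t`. -/
theorem contDiffAt_of_fold_conj {F G H : ℝ → ℝ} (hF : ContDiff ℝ ∞ F) (hG : ContDiff ℝ ∞ G)
    {a : ℝ} (hH : ContinuousAt H a) (hmono : StrictMono H) (hconj : ∀ t, F t = G (H t))
    (hF1 : deriv F a = 0) (hF2 : deriv (deriv F) a ≠ 0) (hG1 : deriv G (H a) = 0)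
    (hG2 : deriv (deriv G) (H a) ≠ 0) : ContDiffAt ℝ ∞ H a := by
  obtain ⟨σ, φ, hσ, hφ, hφ0, hFφ⟩ := exists_fold_normal_form hF hF1 hF2
  obtain ⟨τ, ψ, hτ, hψ, hψ0, hGψ⟩ := exists_fold_normal_form hG hG1 hG2
  have hd : HasDerivAt (fun y => (y - H a) * ψ y) (ψ (H a)) (H a) := by
    have := ((hasDerivAt_id' (H a)).sub_const (H a)).mul
      (hψ.differentiableAt (by simp)).hasDerivAt
    rwa [one_mul, sub_self, zero_mul, add_zero] at this
  refine contDiffAt_of_comp_eventuallyEq (ψ := fun y => (y - H a) * ψ y)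
    (φ := fun t => (t - a) * φ t) hH ((contDiffAt_id.sub contDiffAt_const).mul hψ) hd hψ0.ne'
    ((contDiffAt_id.sub contDiffAt_const).mul hφ) ?_
  filter_upwards [hFφ, hH.eventually hGψ, hφ.continuousAt.eventually (lt_mem_nhds hφ0),
    (hψ.continuousAt.comp hH).eventually (lt_mem_nhds hψ0)] with t h1 h2 h3 h4
  simp only [Function.comp_apply] at h4
  rw [hconj t, h2, ← hconj a] at h1
  set x := (t - a) * φ t with hx
  set y := (H t - H a) * ψ (H t) with hy
  have hxy : σ * x ^ 2 = τ * y ^ 2 := by linarith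
  have hprod : 0 ≤ x * y := by
    rcases lt_trichotomy t a with h | h | h
    · have := hmono h
      have e1 : x < 0 := mul_neg_of_neg_of_pos (by linarith) h3
      have e2 : y < 0 := mul_neg_of_neg_of_pos (by linarith) h4
      nlinarith
    · simp [hx, h]
    · have := hmono h
      have e1 : 0 < x := mul_pos (by linarith) h3
      have e2 : 0 < y := mul_pos (by linarith) h4
      nlinarith
  -- If `σ` and `τ` had opposite signs, both squares would vanish, so this case needs no exclusion.
  have hsq : x ^ 2 = y ^ 2 := by
    rcases hσ with rfl | rfl <;> rcases hτ with rfl | rfl <;>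
      linarith [sq_nonneg x, sq_nonneg y]
  rcases sq_eq_sq_iff_eq_or_eq_neg.1 hsq with h | h
  · exact h.symm
  · have hy2 : y ^ 2 = 0 := le_antisymm (by nlinarith) (sq_nonneg y)
    have hy0 : y = 0 := by simpa using hy2
    rw [h, hy0, neg_zero]

/-- A continuous conjugacy between Morse functions matching their critical points is smooth. -/
theorem contDiff_of_conj {F G H : ℝ → ℝ} (hF : ContDiff ℝ ∞ F) (hG : ContDiff ℝ ∞ G)
    (hFM : IsMorse F) (hGM : IsMorse G) (hH : Continuous H) (hmono : StrictMono H)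
    (hconj : ∀ t, F t = G (H t)) (hcrit : ∀ t, deriv F t = 0 ↔ deriv G (H t) = 0) :
    ContDiff ℝ ∞ H := by
  rw [contDiff_iff_contDiffAt]
  intro t
  by_cases h : deriv F t = 0
  · exact contDiffAt_of_fold_conj hF hG hH.continuousAt hmono hconj h (hFM t h)
      ((hcrit t).1 h) (hGM _ ((hcrit t).1 h))
  · exact contDiffAt_of_comp_eventuallyEq hH.continuousAt hG.contDiffAt
      (hasDerivAt_of_contDiff hG _) (fun h0 => h ((hcrit t).2 h0)) hF.contDiffAt
      (Filter.Eventually.of_forall fun s => (hconj s).symm)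

/-! ### Periodic sequences and conjugacy from matching markings -/

/-- A strictly increasing sequence of reals indexed by the integers which is periodic modulo
`2π`. -/
structure IsAngleSeq (a : ℤ → ℝ) (N : ℕ) : Prop where
  strictMono : StrictMono a
  pos : 0 < N
  add_period : ∀ i, a (i + N) = a i + 2 * Real.pi

namespace IsAngleSeq

variable {a b : ℤ → ℝ} {N : ℕ}

theorem add_mul (ha : IsAngleSeq a N) (i n : ℤ) : a (i + n * N) = a i + n * (2 * Real.pi) := by
  induction n using Int.induction_on with
  | zero => simp
  | succ n ih => rw [_root_.add_mul, one_mul, ← add_assoc, ha.add_period, ih]; push_cast; ring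
  | pred n ih =>
    have := ha.add_period (i + (-n - 1) * N)
    rw [show i + (-n - 1) * (N : ℤ) + N = i + -n * N by ring, ih] at this
    push_cast at this ⊢
    linarith

theorem exists_mem_Ico (ha : IsAngleSeq a N) (t : ℝ) : ∃ i, t ∈ Set.Ico (a i) (a (i + 1)) := by
  have hN := ha.pos
  obtain ⟨m, hm⟩ := exists_int_gt ((t - a 0) / (2 * Real.pi))
  obtain ⟨l, hl⟩ := exists_int_lt ((t - a 0) / (2 * Real.pi))
  rw [div_lt_iff₀ Real.two_pi_pos] at hm
  rw [lt_div_iff₀ Real.two_pi_pos] at hl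
  have h1 := ha.add_mul 0 m
  have h2 := ha.add_mul 0 l
  obtain ⟨i, hi, hmax⟩ := Int.exists_greatest_of_bdd (P := fun i => a i ≤ t)
    ⟨0 + m * N, fun z hz => (ha.strictMono.lt_iff_lt.1 (by linarith : a z < a (0 + m * N))).le⟩
    ⟨0 + l * N, by linarith⟩
  refine ⟨i, hi, lt_of_not_ge fun h => ?_⟩
  have := hmax _ h
  omega

theorem eq_of_mem_Ico (ha : IsAngleSeq a N) {i j : ℤ} {t : ℝ} (hi : t ∈ Set.Ico (a i) (a (i + 1)))
    (hj : t ∈ Set.Ico (a j) (a (j + 1))) : i = j := by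
  have h1 := ha.strictMono.lt_iff_lt.1 (hi.1.trans_lt hj.2)
  have h2 := ha.strictMono.lt_iff_lt.1 (hj.1.trans_lt hi.2)
  omega

end IsAngleSeq

/-- A marking of `F : ℝ → ℝ` by a sequence of angles such that `F` has no critical points between
them and is monotone there in the direction `ε`. -/
structure IsMarking (F : ℝ → ℝ) (a : ℤ → ℝ) (N : ℕ) (ε : ℤ → ℝ) : Prop where
  seq : IsAngleSeq a N
  contDiff : ContDiff ℝ ∞ F
  isMorse : IsMorse F
  deriv_pos : ∀ i, ∀ t ∈ Set.Ioo (a i) (a (i + 1)), 0 < ε i * deriv F t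

namespace IsMarking

variable {F G : ℝ → ℝ} {a b : ℤ → ℝ} {N : ℕ} {ε : ℤ → ℝ}

theorem strictMonoOn (h : IsMarking F a N ε) (i : ℤ) :
    StrictMonoOn (fun t => ε i * F t) (Set.Icc (a i) (a (i + 1))) := by
  refine strictMonoOn_of_deriv_pos (convex_Icc _ _)
    (continuous_const.mul h.contDiff.continuous).continuousOn fun t ht => ?_
  rw [interior_Icc] at ht
  rw [((hasDerivAt_of_contDiff h.contDiff t).const_mul (ε i)).deriv]
  exact h.deriv_pos i t ht

theorem injOn (h : IsMarking F a N ε) (i : ℤ) : Set.InjOn F (Set.Icc (a i) (a (i + 1))) :=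
  fun x hx y hy hxy => (h.strictMonoOn i).injOn hx hy (by simp [hxy])

/-- Points in corresponding intervals with the same values. -/
def Corresponds (F G : ℝ → ℝ) (a b : ℤ → ℝ) (t y : ℝ) : Prop :=
  ∃ i, t ∈ Set.Ico (a i) (a (i + 1)) ∧ y ∈ Set.Ico (b i) (b (i + 1)) ∧ F t = G y

theorem exists_corresponds (hF : IsMarking F a N ε) (hG : IsMarking G b N ε)
    (hab : ∀ i, F (a i) = G (b i)) (t : ℝ) : ∃ y, Corresponds F G a b t y := by
  obtain ⟨i, hi⟩ := hF.seq.exists_mem_Ico t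
  have hlt := hF.seq.strictMono (lt_add_one i)
  have h1 : ε i * F (a i) ≤ ε i * F t := (hF.strictMonoOn i).monotoneOn
    (Set.left_mem_Icc.2 hlt.le) (Set.Ico_subset_Icc_self hi) hi.1
  have h2 : ε i * F t < ε i * F (a (i + 1)) := hF.strictMonoOn i
    (Set.Ico_subset_Icc_self hi) (Set.right_mem_Icc.2 hlt.le) hi.2
  obtain ⟨y, hy, hyt⟩ := intermediate_value_Icc (f := fun t => ε i * G t)
    (hG.seq.strictMono (lt_add_one i)).le
    (continuous_const.mul hG.contDiff.continuous).continuousOn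
    (show ε i * F t ∈ Set.Icc (ε i * G (b i)) (ε i * G (b (i + 1))) by
      rw [← hab, ← hab]; exact ⟨h1, h2.le⟩)
  simp only at hyt
  refine ⟨y, i, hi, ⟨hy.1, lt_of_le_of_ne hy.2 fun h => ?_⟩, ?_⟩
  · rw [h, ← hab] at hyt
    linarith
  -- `ε i` cannot vanish, since `h2` would then read `0 < 0`.
  · refine (mul_left_cancel₀ (fun h0 => ?_) hyt).symm
    simp [h0] at h2

/-- Across intervals the order is that of the indices; inside one interval both functions are
monotone in the same direction. This makes the conjugacy strictly increasing. -/
theorem Corresponds.lt (hF : IsMarking F a N ε) (hG : IsMarking G b N ε) {t t' y y' : ℝ}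
    (h : Corresponds F G a b t y) (h' : Corresponds F G a b t' y') (hlt : t < t') : y < y' := by
  obtain ⟨i, hi, hy, heq⟩ := h
  obtain ⟨j, hj, hy', heq'⟩ := h'
  have hij := hF.seq.strictMono.lt_iff_lt.1 (hi.1.trans_lt (hlt.trans hj.2))
  rcases (Int.lt_add_one_iff.1 hij).lt_or_eq with h1 | rfl
  · exact hy.2.trans_le ((hG.seq.strictMono.monotone (Int.add_one_le_iff.2 h1)).trans hy'.1)
  · have := hF.strictMonoOn i (Set.Ico_subset_Icc_self hi) (Set.Ico_subset_Icc_self hj) hlt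
    simp only [heq, heq'] at this
    exact ((hG.strictMonoOn i).lt_iff_lt (Set.Ico_subset_Icc_self hy)
      (Set.Ico_subset_Icc_self hy')).1 this

theorem Corresponds.symm {t y : ℝ} (h : Corresponds F G a b t y) : Corresponds G F b a y t := by
  obtain ⟨i, hi, hy, heq⟩ := h
  exact ⟨i, hy, hi, heq.symm⟩

theorem Corresponds.eq (hF : IsMarking F a N ε) (hG : IsMarking G b N ε) {t y y' : ℝ}
    (h : Corresponds F G a b t y) (h' : Corresponds F G a b t y') : y = y' := by
  obtain ⟨i, hi, hy, heq⟩ := h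
  obtain ⟨j, hj, hy', heq'⟩ := h'
  obtain rfl := hF.seq.eq_of_mem_Ico hi hj
  exact hG.injOn i (Set.Ico_subset_Icc_self hy) (Set.Ico_subset_Icc_self hy')
    (heq.symm.trans heq')

theorem Corresponds.add_period (hF : IsMarking F a N ε) (hG : IsMarking G b N ε) {c : ℝ}
    (hFc : ∀ t, F (t + 2 * Real.pi) = F t + c) (hGc : ∀ t, G (t + 2 * Real.pi) = G t + c)
    {t y : ℝ} (h : Corresponds F G a b t y) :
    Corresponds F G a b (t + 2 * Real.pi) (y + 2 * Real.pi) := by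
  obtain ⟨i, hi, hy, heq⟩ := h
  refine ⟨i + N, ?_, ?_, by rw [hFc, hGc, heq]⟩
  · rw [add_right_comm, hF.seq.add_period, hF.seq.add_period]
    exact ⟨by linarith [hi.1], by linarith [hi.2]⟩
  · rw [add_right_comm, hG.seq.add_period, hG.seq.add_period]
    exact ⟨by linarith [hy.1], by linarith [hy.2]⟩

theorem Corresponds.deriv_eq_zero (hF : IsMarking F a N ε) (hG : IsMarking G b N ε)
    (hab : ∀ i, F (a i) = G (b i)) (hcrit : ∀ i, deriv F (a i) = 0 ↔ deriv G (b i) = 0)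
    {t y : ℝ} (h : Corresponds F G a b t y) (h0 : deriv F t = 0) : deriv G y = 0 := by
  obtain ⟨i, hi, hy, heq⟩ := h
  rcases hi.1.eq_or_lt with h1 | h1
  · have hlt := hG.seq.strictMono (lt_add_one i)
    have : y = b i := hG.injOn i (Set.Ico_subset_Icc_self hy) (Set.left_mem_Icc.2 hlt.le)
      (by rw [← heq, ← h1, hab])
    rw [this, ← hcrit, h1, h0]
  · have := hF.deriv_pos i t ⟨h1, hi.2⟩
    simp [h0] at this

/-- Maps with matching markings are conjugate by a diffeomorphism of the source. -/
theorem exists_conj (hF : IsMarking F a N ε) (hG : IsMarking G b N ε)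
    (hab : ∀ i, F (a i) = G (b i)) (hcrit : ∀ i, deriv F (a i) = 0 ↔ deriv G (b i) = 0) {c : ℝ}
    (hFc : ∀ t, F (t + 2 * Real.pi) = F t + c) (hGc : ∀ t, G (t + 2 * Real.pi) = G t + c) :
    ∃ H Hi, IsEquivariantDiffeo H Hi 1 ∧ ∀ t, F t = G (H t) := by
  choose H hH using hF.exists_corresponds hG hab
  have hmono : StrictMono H := fun t t' h => (hH t).lt hF hG (hH t') h
  have hsurj : Function.Surjective H := fun y => by
    obtain ⟨t, ht⟩ := hG.exists_corresponds hF (fun i => (hab i).symm) y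
    exact ⟨t, (hH t).eq hF hG ht.symm⟩
  -- A strictly increasing surjection of the line is a homeomorphism, so continuity of `H` and of
  -- its inverse comes for free.
  set e := hmono.orderIsoOfSurjective H hsurj with he
  have hconj : ∀ t, F t = G (H t) := fun t => by
    obtain ⟨i, -, -, h⟩ := hH t
    exact h
  have hd : ∀ t, deriv F t = 0 ↔ deriv G (H t) = 0 := fun t =>
    ⟨(hH t).deriv_eq_zero hF hG hab hcrit,
      (hH t).symm.deriv_eq_zero hG hF (fun i => (hab i).symm) (fun i => (hcrit i).symm)⟩
  have heq : ∀ y, H (e.symm y) = y := e.apply_symm_apply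
  refine ⟨H, e.symm, ⟨?_, ?_, e.symm_apply_apply, heq, Or.inl rfl, fun t => ?_⟩, hconj⟩
  · exact contDiff_of_conj hF.contDiff hG.contDiff hF.isMorse hG.isMorse e.continuous hmono hconj hd
  · exact contDiff_of_conj hG.contDiff hF.contDiff hG.isMorse hF.isMorse e.symm.continuous
      e.symm.strictMono (fun y => by rw [hconj, heq]) fun y => by rw [hd, heq]
  · rw [Int.cast_one, one_mul]
    exact (hH _).eq hF hG ((hH t).add_period hF hG hFc hGc)

end IsMarking

/-! ### Diffeomorphisms matching two periodic sequences -/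

namespace IsAngleSeq

variable {a u v : ℤ → ℝ} {N m : ℕ}

theorem shift (ha : IsAngleSeq a N) (c : ℤ) : IsAngleSeq (fun i => a (i + c)) N :=
  ⟨fun i j h => ha.strictMono (by omega), ha.pos, fun i => by
    rw [add_right_comm, ha.add_period]⟩

theorem reflect (ha : IsAngleSeq a N) : IsAngleSeq (fun i => -a (-i)) N :=
  ⟨fun i j h => neg_lt_neg (ha.strictMono (by omega)), ha.pos, fun i => by
    have := ha.add_period (-(i + N))
    rw [show -(i + (N : ℤ)) + N = -i by ring] at this
    linarith⟩

/-- The positive lower bound of the slopes between two sequences. -/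
theorem exists_slope_bound (hv : IsAngleSeq v m) (hu : IsAngleSeq u m) :
    ∃ c > 0, ∀ j, c * (v (j + 1) - v j) ≤ u (j + 1) - u j := by
  have hm : (0 : ℤ) < m := by exact_mod_cast hv.pos
  set r : ℤ → ℝ := fun j => (u (j + 1) - u j) / (v (j + 1) - v j) with hr
  have hvp : ∀ j, 0 < v (j + 1) - v j := fun j => sub_pos.2 (hv.strictMono (lt_add_one j))
  have hup : ∀ j, 0 < u (j + 1) - u j := fun j => sub_pos.2 (hu.strictMono (lt_add_one j))
  obtain ⟨i, -, hmin⟩ := Finset.exists_min_image (Finset.Ico (0 : ℤ) m) r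
    ⟨0, Finset.mem_Ico.2 ⟨le_rfl, hm⟩⟩
  refine ⟨r i, div_pos (hup i) (hvp i), fun j => ?_⟩
  rw [← le_div_iff₀ (hvp j)]
  have h1 : r j = r (j % m) := by
    have h2 := Int.emod_add_mul_ediv j m
    have e1 : j % m = j + (-(j / m)) * m := by linarith [mul_comm (j / (m : ℤ)) m]
    simp only [hr]
    rw [e1, add_right_comm, hv.add_mul, hu.add_mul, hv.add_mul, hu.add_mul]
    congr 1 <;> ring
  change r i ≤ r j
  rw [h1]
  exact hmin _ (Finset.mem_Ico.2 ⟨Int.emod_nonneg _ hm.ne', Int.emod_lt_of_pos _ hm⟩)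

/-- Two periodic sequences of angles of the same length are matched by an equivariant
diffeomorphism. -/
theorem exists_isEquivariantDiffeo (hv : IsAngleSeq v m) (hu : IsAngleSeq u m) :
    ∃ K Ki, IsEquivariantDiffeo K Ki 1 ∧ (∀ t, 0 < deriv K t) ∧ ∀ j, K (v j) = u j := by
  obtain ⟨c, hc, hcu⟩ := hv.exists_slope_bound hu
  set ℓ : ℤ → ℝ := fun j => v (j + 1) - v j with hℓ
  have hℓp : ∀ j, 0 < ℓ j := fun j => sub_pos.2 (hv.strictMono (lt_add_one j))
  set L : ℤ → ℝ := fun j => u (j + 1) - u j - c * ℓ j with hL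
  have hLp : ∀ j, 0 ≤ L j := fun j => sub_nonneg.2 (hcu j)
  -- Slope `c` throughout, with the missing height `L j ≥ 0` gained in the middle third of the
  -- interval. Near `v j` both adjacent pieces are therefore `u j + c * (t - v j)`, and they glue
  -- smoothly.
  set P : ℤ → ℝ → ℝ := fun j t =>
    u j + c * (t - v j) + L j * Real.smoothTransition (3 * (t - v j) / ℓ j - 1) with hP
  have hPs : ∀ j, ContDiff ℝ ∞ (P j) := fun j => by
    refine (contDiff_const.add (contDiff_const.mul (contDiff_id.sub contDiff_const))).add
      (contDiff_const.mul (Real.smoothTransition.contDiff.comp ?_))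
    exact ((contDiff_const.mul (contDiff_id.sub contDiff_const)).div_const _).sub contDiff_const
  have hPmono : ∀ j, Monotone (fun t => P j t - c * t) := fun j s t hst => by
    have : Real.smoothTransition (3 * (s - v j) / ℓ j - 1) ≤
        Real.smoothTransition (3 * (t - v j) / ℓ j - 1) := by
      apply Real.smoothTransition.monotone
      have := hℓp j
      gcongr
    have := mul_le_mul_of_nonneg_left this (hLp j)
    simp only [hP]
    linarith
  choose idx hidx using hv.exists_mem_Ico
  set K : ℝ → ℝ := fun t => P (idx t) t with hK
  -- The range includes the last third of the preceding interval, so it is an open neighbourhood of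
  -- `v j`.
  have hKP : ∀ j, ∀ t ∈ Set.Ioo (v j - ℓ (j - 1) / 3) (v (j + 1)), K t = P j t := by
    intro j t ht
    rcases le_or_gt (v j) t with h | h
    · have : idx t = j := hv.eq_of_mem_Ico (hidx t) ⟨h, ht.2⟩
      simp only [hK, this]
    · have hj : v (j - 1) = v j - ℓ (j - 1) := by simp [hℓ]
      have hlp := hℓp (j - 1)
      have : idx t = j - 1 := hv.eq_of_mem_Ico (hidx t)
        ⟨by rw [hj]; linarith [ht.1], by rwa [sub_add_cancel]⟩
      simp only [hK, this, hP]
      rw [Real.smoothTransition.one_of_one_le, Real.smoothTransition.zero_of_nonpos]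
      · simp only [hL, hℓ, sub_add_cancel]; ring
      · have : 3 * (t - v j) / ℓ j ≤ 0 := div_nonpos_of_nonpos_of_nonneg (by linarith) (hℓp j).le
        linarith
      · rw [le_sub_iff_add_le, le_div_iff₀ hlp, hj]
        linarith [ht.1]
  have hKloc : ∀ t, K =ᶠ[nhds t] P (idx t) := fun t => by
    filter_upwards [Ioo_mem_nhds (show v (idx t) - ℓ (idx t - 1) / 3 < t by
      linarith [(hidx t).1, hℓp (idx t - 1)]) (hidx t).2] with s hs using hKP _ s hs
  have hKs : ContDiff ℝ ∞ K :=
    contDiff_iff_contDiffAt.2 fun t => (hPs _).contDiffAt.congr_of_eventuallyEq (hKloc t)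
  have hKd : ∀ t, 0 < deriv K t := fun t => by
    have h1 := (hPmono (idx t)).deriv_nonneg (x := t)
    have h2 : deriv (fun t' => P (idx t) t' - c * t') t = deriv (P (idx t)) t - c * 1 :=
      ((hasDerivAt_of_contDiff (hPs (idx t)) t).sub ((hasDerivAt_id' t).const_mul c)).deriv
    rw [h2] at h1
    rw [(hKloc t).deriv_eq]
    linarith
  have hKper : ∀ t, K (t + 2 * Real.pi) = K t + 2 * Real.pi := fun t => by
    have h1 : idx (t + 2 * Real.pi) = idx t + m := hv.eq_of_mem_Ico (hidx _) (by
      rw [add_right_comm, hv.add_period, hv.add_period]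
      exact ⟨by linarith [(hidx t).1], by linarith [(hidx t).2]⟩)
    have h2 : ℓ (idx t + m) = ℓ (idx t) := by
      simp only [hℓ]; rw [add_right_comm, hv.add_period, hv.add_period]; ring
    have h3 : L (idx t + m) = L (idx t) := by
      simp only [hL, h2]; rw [add_right_comm, hu.add_period, hu.add_period]; ring
    simp only [hK, h1, hP, h2, h3, hv.add_period, hu.add_period, add_sub_add_right_eq_sub]
    ring
  have hKv : ∀ j, K (v j) = u j := fun j => by
    rw [hKP j _ ⟨by linarith [hℓp (j - 1)], hv.strictMono (lt_add_one j)⟩]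
    simp [hP, Real.smoothTransition.zero_of_nonpos]
  have hmono : StrictMono K := strictMono_of_deriv_pos hKd
  have hper' := map_add_int_mul hKper
  have hsurj : Function.Surjective K := fun y => by
    refine mem_range_of_exists_le_of_exists_ge hKs.continuous ?_ ?_
    · obtain ⟨n, hn⟩ := exists_int_lt ((y - K 0) / (2 * Real.pi))
      rw [lt_div_iff₀ Real.two_pi_pos] at hn
      exact ⟨0 + n * (2 * Real.pi), by rw [hper']; linarith⟩
    · obtain ⟨n, hn⟩ := exists_int_gt ((y - K 0) / (2 * Real.pi))
      rw [div_lt_iff₀ Real.two_pi_pos] at hn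
      exact ⟨0 + n * (2 * Real.pi), by rw [hper']; linarith⟩
  set e := hmono.orderIsoOfSurjective K hsurj with he
  have heq : ∀ y, K (e.symm y) = y := e.apply_symm_apply
  refine ⟨K, e.symm, ⟨hKs, ?_, e.symm_apply_apply, heq, Or.inl rfl, fun t => ?_⟩, hKd, hKv⟩
  · exact contDiff_iff_contDiffAt.2 fun t => contDiffAt_of_comp_eventuallyEq
      e.symm.continuous.continuousAt hKs.contDiffAt (hasDerivAt_of_contDiff hKs _)
      (hKd _).ne' contDiffAt_id (Filter.Eventually.of_forall heq)
  · rw [hKper, Int.cast_one, one_mul]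

end IsAngleSeq

/-! ### The walk of a map through its marked values -/

theorem sign_eq_of_deriv_ne_zero {F : ℝ → ℝ} (hF : ContDiff ℝ ∞ F) {x c y σ τ : ℝ} (hxc : x < c)
    (hcy : c < y) (hl : ∀ t ∈ Set.Ioo x c, 0 < σ * deriv F t)
    (hr : ∀ t ∈ Set.Ioo c y, 0 < τ * deriv F t) (h0 : deriv F c ≠ 0) : 0 < σ * τ := by
  have hc := ((contDiff_deriv_of_contDiff hF).continuous.mul
    (continuous_const (y := deriv F c))).continuousAt.eventually
      (lt_mem_nhds (a := 0) (mul_self_pos.2 h0))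
  obtain ⟨t, ht, ht'⟩ := ((hc.filter_mono nhdsWithin_le_nhds).and (Ioo_mem_nhdsLT hxc)).exists
  obtain ⟨s, hs, hs'⟩ := ((hc.filter_mono nhdsWithin_le_nhds).and (Ioo_mem_nhdsGT hcy)).exists
  have h1 := mul_pos (mul_pos (hl t ht') (hr s hs')) (mul_pos ht hs)
  have h2 : σ * deriv F t * (τ * deriv F s) * (deriv F t * deriv F c * (deriv F s * deriv F c)) =
    σ * τ * (deriv F t * deriv F s * deriv F c) ^ 2 := by ring
  have h3 : 0 < σ * τ * (deriv F t * deriv F s * deriv F c) ^ 2 := h2 ▸ h1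
  exact pos_of_mul_pos_left h3 (sq_nonneg _)

/-- Hadamard's lemma gives `F' = (t - c) p` with `p c ≠ 0`, so `F'` changes sign at `c`. -/
theorem sign_eq_neg_of_deriv_eq_zero {F : ℝ → ℝ} (hF : ContDiff ℝ ∞ F) {x c y σ τ : ℝ}
    (hxc : x < c) (hcy : c < y) (hl : ∀ t ∈ Set.Ioo x c, 0 < σ * deriv F t)
    (hr : ∀ t ∈ Set.Ioo c y, 0 < τ * deriv F t) (h0 : deriv F c = 0)
    (h1 : deriv (deriv F) c ≠ 0) : σ * τ < 0 := by
  obtain ⟨p, hp, hFp⟩ := exists_contDiff_eq_sub_mul (contDiff_deriv_of_contDiff hF) h0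
  have hpc : p c ≠ 0 := by
    have := ((hasDerivAt_id' c).sub_const c).mul (hasDerivAt_of_contDiff hp c)
    rw [one_mul, sub_self, zero_mul, add_zero] at this
    rwa [← (this.congr_of_eventuallyEq (Filter.Eventually.of_forall hFp)).deriv]
  have hc := (hp.continuous.mul (continuous_const (y := p c))).continuousAt.eventually
    (lt_mem_nhds (a := 0) (mul_self_pos.2 hpc))
  obtain ⟨t, ht, ht'⟩ := ((hc.filter_mono nhdsWithin_le_nhds).and (Ioo_mem_nhdsLT hxc)).exists
  obtain ⟨s, hs, hs'⟩ := ((hc.filter_mono nhdsWithin_le_nhds).and (Ioo_mem_nhdsGT hcy)).exists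
  have h2 := mul_pos (mul_pos (mul_pos (hl t ht') (hr s hs')) (mul_pos ht hs))
    (mul_pos (sub_pos.2 ht'.2) (sub_pos.2 hs'.1))
  have h3 : σ * deriv F t * (τ * deriv F s) * (p t * p c * (p s * p c)) * ((c - t) * (s - c)) =
      (-(σ * τ)) * (p t * p s * p c * ((c - t) * (s - c))) ^ 2 := by
    rw [hFp t, hFp s]; ring
  have h4 : 0 < (-(σ * τ)) * (p t * p s * p c * ((c - t) * (s - c))) ^ 2 := h3 ▸ h2
  linarith [pos_of_mul_pos_left h4 (sq_nonneg _)]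

/-- The values of `F` on a marking run along the sequence `v` by steps `ε`, which change their
direction exactly at the critical points. -/
structure IsFoldWalk (F : ℝ → ℝ) (a : ℤ → ℝ) (N : ℕ) (v : ℤ → ℝ) (m : ℕ) (ε w : ℤ → ℤ) :
    Prop where
  marking : IsMarking F a N (fun i => (ε i : ℝ))
  values : IsAngleSeq v m
  map_eq : ∀ i, F (a i) = v (w i)
  step : ∀ i, w (i + 1) = w i + ε i
  sign : ∀ i, ε i = 1 ∨ ε i = -1
  turn : ∀ i, deriv F (a (i + 1)) = 0 → ε (i + 1) = -ε i
  keep : ∀ i, deriv F (a (i + 1)) ≠ 0 → ε (i + 1) = ε i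

/-- Inside an interval between marked points no value `v j` is attained, so by the intermediate
value theorem its endpoint values are neighbours in `v`. -/
theorem exists_isFoldWalk {F : ℝ → ℝ} {a v : ℤ → ℝ} {N m : ℕ} (ha : IsAngleSeq a N)
    (hv : IsAngleSeq v m) (hF : ContDiff ℝ ∞ F) (hM : IsMorse F)
    (hrange : ∀ t, t ∈ Set.range a ↔ F t ∈ Set.range v)
    (hcrit : ∀ t, deriv F t = 0 → t ∈ Set.range a) : ∃ ε w, IsFoldWalk F a N v m ε w := by
  have hnot : ∀ i, ∀ t ∈ Set.Ioo (a i) (a (i + 1)), t ∉ Set.range a := by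
    rintro i _ ⟨h1, h2⟩ ⟨j, rfl⟩
    have := ha.strictMono.lt_iff_lt.1 h1
    have := ha.strictMono.lt_iff_lt.1 h2
    omega
  have hε : ∀ i, ∃ ε : ℤ, (ε = 1 ∨ ε = -1) ∧
      ∀ t ∈ Set.Ioo (a i) (a (i + 1)), 0 < (ε : ℝ) * deriv F t := by
    intro i
    rcases hasDerivWithinAt_forall_lt_or_forall_gt_of_forall_ne (convex_Ioo (a i) (a (i + 1)))
      (f := F) (fun t _ => (hasDerivAt_of_contDiff hF t).hasDerivWithinAt)
      (m := 0) (fun t ht h0 => hnot i t ht (hcrit t h0)) with h | h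
    · exact ⟨-1, Or.inr rfl, fun t ht => by push_cast; linarith [h t ht]⟩
    · exact ⟨1, Or.inl rfl, fun t ht => by push_cast; linarith [h t ht]⟩
  choose ε hε hpos using hε
  have hw : ∀ i, ∃ w, v w = F (a i) := fun i => (hrange (a i)).1 ⟨i, rfl⟩
  choose w hw using hw
  have hmark : IsMarking F a N (fun i => (ε i : ℝ)) := ⟨ha, hF, hM, hpos⟩
  refine ⟨ε, w, hmark, hv, fun i => (hw i).symm, fun i => ?_, hε, fun i h0 => ?_, fun i h0 => ?_⟩
  · have hlt := ha.strictMono (lt_add_one i)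
    have hmono := hmark.strictMonoOn i (Set.left_mem_Icc.2 hlt.le) (Set.right_mem_Icc.2 hlt.le) hlt
    have hskip : ∀ j, v j ∉ F '' Set.Ioo (a i) (a (i + 1)) := by
      rintro j ⟨t, ht, htj⟩
      exact hnot i t ht ((hrange t).2 ⟨j, htj.symm⟩)
    rcases hε i with h | h
    · simp only [h, Int.cast_one, one_mul, ← hw] at hmono
      have h1 := hv.strictMono.lt_iff_lt.1 hmono
      by_contra hne
      refine hskip (w i + 1) (intermediate_value_Ioo hlt.le hF.continuous.continuousOn ?_)
      rw [← hw, ← hw]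
      exact ⟨hv.strictMono (by omega), hv.strictMono (by omega)⟩
    · simp only [h, Int.cast_neg, Int.cast_one, neg_mul, one_mul, ← hw, neg_lt_neg_iff] at hmono
      have h1 := hv.strictMono.lt_iff_lt.1 hmono
      by_contra hne
      refine hskip (w i - 1) (intermediate_value_Ioo' hlt.le hF.continuous.continuousOn ?_)
      rw [← hw, ← hw]
      exact ⟨hv.strictMono (by omega), hv.strictMono (by omega)⟩
  · have h1 := sign_eq_neg_of_deriv_eq_zero hF (ha.strictMono (lt_add_one i))
      (ha.strictMono (lt_add_one (i + 1))) (hpos i) (hpos (i + 1)) h0 (hM _ h0)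
    have h2 : ε i * ε (i + 1) < 0 := by exact_mod_cast h1
    rcases hε i with h | h <;> rcases hε (i + 1) with h' | h' <;> simp [h, h'] at h2 ⊢
  · have h1 := sign_eq_of_deriv_ne_zero hF (ha.strictMono (lt_add_one i))
      (ha.strictMono (lt_add_one (i + 1))) (hpos i) (hpos (i + 1)) h0
    have h2 : 0 < ε i * ε (i + 1) := by exact_mod_cast h1
    rcases hε i with h | h <;> rcases hε (i + 1) with h' | h' <;> simp [h, h'] at h2 ⊢

theorem IsMarking.comp_left {F K : ℝ → ℝ} {a : ℤ → ℝ} {N : ℕ} {ε : ℤ → ℝ}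
    (h : IsMarking F a N ε) (hK : ContDiff ℝ ∞ K) (hKd : ∀ t, 0 < deriv K t) :
    IsMarking (fun t => K (F t)) a N ε ∧
      ∀ t, deriv (fun t => K (F t)) t = 0 ↔ deriv F t = 0 := by
  have hd : deriv (fun t => K (F t)) = fun t => deriv K (F t) * deriv F t := funext fun t =>
    ((hasDerivAt_of_contDiff hK _).comp t (hasDerivAt_of_contDiff h.contDiff t)).deriv
  have hz : ∀ t, deriv (fun t => K (F t)) t = 0 ↔ deriv F t = 0 := fun t => by
    rw [hd]; simp [(hKd (F t)).ne']
  refine ⟨⟨h.seq, hK.comp h.contDiff, fun t h0 => ?_, fun i t ht => ?_⟩, hz⟩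
  · have h0' := (hz t).1 h0
    have h1 := ((hasDerivAt_of_contDiff (contDiff_deriv_of_contDiff hK) (F t)).comp t
      (hasDerivAt_of_contDiff h.contDiff t)).mul
        (hasDerivAt_of_contDiff (contDiff_deriv_of_contDiff h.contDiff) t)
    rw [h0', mul_zero, zero_add] at h1
    have h2 : deriv (fun t => deriv K (F t) * deriv F t) t =
        (deriv K ∘ F) t * deriv (deriv F) t := h1.deriv
    rw [hd, h2]
    exact mul_ne_zero (hKd _).ne' (h.isMorse t h0')
  · rw [hd, mul_left_comm]
    exact mul_pos (hKd _) (h.deriv_pos i t ht)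

namespace IsFoldWalk

variable {F G : ℝ → ℝ} {a b v u : ℤ → ℝ} {N m : ℕ} {ε ε' w w' : ℤ → ℤ}

/-- Reflection of the target; it reduces opposite initial directions to equal ones. -/
theorem neg (h : IsFoldWalk F a N v m ε w) :
    IsFoldWalk (fun t => -F t) a N (fun j => -v (-j)) m (fun i => -ε i) (fun i => -w i) := by
  have hd : deriv (fun t => -F t) = fun t => -deriv F t := funext fun t => deriv.fun_neg
  have hm := h.marking
  refine ⟨⟨hm.seq, hm.contDiff.neg, fun t h0 => ?_, fun i t ht => ?_⟩, h.values.reflect,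
    fun i => ?_, fun i => ?_, fun i => ?_, fun i h0 => ?_, fun i h0 => ?_⟩
  · rw [hd] at h0 ⊢
    rw [deriv.fun_neg, neg_ne_zero]
    exact hm.isMorse t (neg_eq_zero.1 h0)
  · rw [hd]
    have := hm.deriv_pos i t ht
    push_cast
    linarith
  · simp [h.map_eq]
  · rw [h.step]; ring
  · rcases h.sign i with h | h <;> simp [h]
  · rw [hd] at h0
    rw [h.turn i (neg_eq_zero.1 h0)]
  · rw [hd] at h0
    rw [h.keep i (neg_ne_zero.1 h0)]

/-- Turning or keeping direction depends only on the critical pattern, so `ε 0` propagates both ways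
along `ℤ`. -/
theorem sign_eq_of_sign_zero_eq (hF : IsFoldWalk F a N v m ε w) (hG : IsFoldWalk G b N u m ε' w')
    (hcrit : ∀ i, deriv F (a i) = 0 ↔ deriv G (b i) = 0) (h0 : ε 0 = ε' 0) (i : ℤ) :
    ε i = ε' i := by
  have hstep : ∀ i, ε (i + 1) = ε' (i + 1) ↔ ε i = ε' i := fun i => by
    by_cases h : deriv F (a (i + 1)) = 0
    · rw [hF.turn i h, hG.turn i ((hcrit _).1 h), neg_inj]
    · rw [hF.keep i h, hG.keep i fun h' => h ((hcrit _).2 h')]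
  induction i using Int.induction_on with
  | zero => exact h0
  | succ n ih => exact (hstep _).2 ih
  | pred n ih =>
    rw [← hstep, sub_add_cancel]
    exact ih

theorem walk_eq (hF : IsFoldWalk F a N v m ε w) (hG : IsFoldWalk G b N u m ε' w')
    (hε : ∀ i, ε i = ε' i) (i : ℤ) : w' i = w i + (w' 0 - w 0) := by
  induction i using Int.induction_on with
  | zero => ring
  | succ n ih => rw [hF.step, hG.step, ih, hε]; ring
  | pred n ih =>
    have h1 := hF.step (-n - 1)
    have h2 := hG.step (-n - 1)
    have h3 := hε (-n - 1)
    rw [sub_add_cancel] at h1 h2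
    omega

/-- Maps with the same pattern of critical points, starting in the same direction, are
conjugate. -/
theorem exists_conj_of_sign_zero_eq (hF : IsFoldWalk F a N v m ε w)
    (hG : IsFoldWalk G b N u m ε' w') (hcrit : ∀ i, deriv F (a i) = 0 ↔ deriv G (b i) = 0)
    (h0 : ε 0 = ε' 0) {d d' : ℤ} (hd : ∀ t, F (t + 2 * Real.pi) = F t + d * (2 * Real.pi))
    (hd' : ∀ t, G (t + 2 * Real.pi) = G t + d' * (2 * Real.pi)) :
    ∃ H Hi K Ki : ℝ → ℝ, IsEquivariantDiffeo H Hi 1 ∧ IsEquivariantDiffeo K Ki 1 ∧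
      ∀ t, K (F t) = G (H t) := by
  have hε := hF.sign_eq_of_sign_zero_eq hG hcrit h0
  have hw := hF.walk_eq hG hε
  -- The walks differ by the translation `w' 0 - w 0`; shifting `u` by it makes `K ∘ F` and `G`
  -- agree at corresponding marked points.
  obtain ⟨K, Ki, hK, hKd, hKv⟩ := hF.values.exists_isEquivariantDiffeo
    (hG.values.shift (w' 0 - w 0))
  obtain ⟨hKF, hKz⟩ := hF.marking.comp_left hK.contDiff hKd
  have hGm := hG.marking
  simp only [← hε] at hGm
  have hab : ∀ i, K (F (a i)) = G (b i) := fun i => by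
    rw [hF.map_eq, hKv, hG.map_eq, ← hw]
  have hKper : ∀ t, K (F (t + 2 * Real.pi)) = K (F t) + d * (2 * Real.pi) := fun t => by
    rw [hd]
    refine map_add_int_mul (fun t => ?_) d (F t)
    rw [hK.add_period, Int.cast_one, one_mul]
  -- Equality of degrees is automatic: compare the values at indices `0` and `N`.
  have hdd : (d' : ℝ) * (2 * Real.pi) = d * (2 * Real.pi) := by
    have h1 := hab (0 + N)
    rw [hF.marking.seq.add_period, hG.marking.seq.add_period, hKper, hd', hab] at h1
    linarith
  obtain ⟨H, Hi, hH, hconj⟩ := hKF.exists_conj hGm hab (fun i => (hKz _).trans (hcrit i)) hKper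
    (fun t => by rw [hd', hdd])
  exact ⟨H, Hi, K, Ki, hH, hK, hconj⟩

/-- Maps with the same pattern of critical points are conjugate. -/
theorem exists_conj (hF : IsFoldWalk F a N v m ε w) (hG : IsFoldWalk G b N u m ε' w')
    (hcrit : ∀ i, deriv F (a i) = 0 ↔ deriv G (b i) = 0)
    {d d' : ℤ} (hd : ∀ t, F (t + 2 * Real.pi) = F t + d * (2 * Real.pi))
    (hd' : ∀ t, G (t + 2 * Real.pi) = G t + d' * (2 * Real.pi)) :
    ∃ H Hi K Ki : ℝ → ℝ, ∃ e e' : ℤ, IsEquivariantDiffeo H Hi e ∧ IsEquivariantDiffeo K Ki e' ∧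
      ∀ t, K (F t) = G (H t) := by
  by_cases h0 : ε 0 = ε' 0
  · obtain ⟨H, Hi, K, Ki, hH, hK, h⟩ := hF.exists_conj_of_sign_zero_eq hG hcrit h0 hd hd'
    exact ⟨H, Hi, K, Ki, 1, 1, hH, hK, h⟩
  · have h0' : ε 0 = -ε' 0 := by
      rcases hF.sign 0 with h | h <;> rcases hG.sign 0 with h' | h' <;> simp [h, h'] at h0 ⊢
    obtain ⟨H, Hi, K, Ki, hH, hK, h⟩ := hF.exists_conj_of_sign_zero_eq hG.neg
      (fun i => by rw [hcrit, deriv.fun_neg, neg_eq_zero]) h0' hd (d' := -d')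
      (fun t => by rw [hd']; push_cast; ring)
    exact ⟨H, Hi, _, _, 1, _, hH, IsEquivariantDiffeo.neg.comp hK, fun t => by rw [h, neg_neg]⟩

/-- The number of marked points of an immersion in terms of its degree. -/
theorem degree_mul_eq (hF : IsFoldWalk F a N v m ε w) (hcrit : ∀ t, deriv F t ≠ 0) {d : ℤ}
    (hd : ∀ t, F (t + 2 * Real.pi) = F t + d * (2 * Real.pi)) : d * m = ε 0 * N := by
  have hε : ∀ i : ℕ, ε i = ε 0 := fun i => by
    induction i with
    | zero => rfl
    | succ n ih => push_cast; rw [hF.keep _ (hcrit _), ih]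
  have hw : ∀ i : ℕ, w i = w 0 + ε 0 * i := fun i => by
    induction i with
    | zero => simp
    | succ n ih => push_cast; rw [hF.step, hε, ih]; ring
  -- Over one period the walk advances by `ε 0 * N` unidirectional steps, while `F` passes `d`
  -- periods of `m` values each.
  have h1 := hF.map_eq (0 + N)
  rw [hF.marking.seq.add_period, hd, hF.map_eq, ← hF.values.add_mul, zero_add, hw] at h1
  have := hF.values.strictMono.injective h1
  linarith

end IsFoldWalk

/-- Morse functions with marked points `a`, `b` over value sequences `v`, `u` are conjugate if the
critical points among the marked points correspond to each other under the index change
`i ↦ s * i + c`. -/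
theorem exists_conj_of_pattern {F G : ℝ → ℝ} {a b v u : ℤ → ℝ} {N m : ℕ} (ha : IsAngleSeq a N)
    (hb : IsAngleSeq b N) (hv : IsAngleSeq v m) (hu : IsAngleSeq u m) (hF : ContDiff ℝ ∞ F)
    (hG : ContDiff ℝ ∞ G) (hFM : IsMorse F) (hGM : IsMorse G)
    (hav : ∀ t, t ∈ Set.range a ↔ F t ∈ Set.range v)
    (hbu : ∀ t, t ∈ Set.range b ↔ G t ∈ Set.range u)
    (haF : ∀ t, deriv F t = 0 → t ∈ Set.range a) (hbG : ∀ t, deriv G t = 0 → t ∈ Set.range b)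
    {d d' : ℤ} (hd : ∀ t, F (t + 2 * Real.pi) = F t + d * (2 * Real.pi))
    (hd' : ∀ t, G (t + 2 * Real.pi) = G t + d' * (2 * Real.pi))
    {s c : ℤ} (hs : s = 1 ∨ s = -1)
    (hcrit : ∀ i, deriv F (a i) = 0 ↔ deriv G (b (s * i + c)) = 0) :
    ∃ H Hi K Ki : ℝ → ℝ, ∃ e e' : ℤ, IsEquivariantDiffeo H Hi e ∧ IsEquivariantDiffeo K Ki e' ∧
      ∀ t, K (F t) = G (H t) := by
  obtain ⟨ε, w, hFw⟩ := exists_isFoldWalk ha hv hF hFM hav haF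
  rcases hs with rfl | rfl
  · have hr : Set.range (fun i => b (i + c)) = Set.range b :=
      (Equiv.addRight c).surjective.range_comp b
    obtain ⟨ε', w', hGw⟩ := exists_isFoldWalk (hb.shift c) hu hG hGM
      (fun t => by rw [hr, hbu]) (fun t ht => by rw [hr]; exact hbG t ht)
    exact hFw.exists_conj hGw (fun i => by simpa using hcrit i) hd hd'
  -- For `s = -1` the source is reflected: `t ↦ G (-t)` has marked sequence `i ↦ -b (-i + c)`.
  · have hder : deriv (fun t => G (-t)) = fun t => -deriv G (-t) := funext fun t => by
      rw [deriv_comp_neg]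
    have hr : ∀ t, t ∈ Set.range (fun i => -b (-i + c)) ↔ -t ∈ Set.range b := fun t => by
      constructor
      · rintro ⟨i, rfl⟩
        exact ⟨-i + c, by simp⟩
      · rintro ⟨i, hi⟩
        exact ⟨c - i, by simp [hi]⟩
    obtain ⟨ε', w', hGw⟩ := exists_isFoldWalk (F := fun t => G (-t)) (hb.shift c).reflect hu
      (hG.comp contDiff_neg)
      (fun t h0 => by
        rw [hder] at h0 ⊢
        rw [deriv.fun_neg, deriv_comp_neg, neg_neg]
        exact hGM _ (neg_eq_zero.1 h0))
      (fun t => by rw [hr, hbu])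
      (fun t ht => by
        rw [hr]
        rw [hder] at ht
        exact hbG _ (neg_eq_zero.1 ht))
    obtain ⟨H, Hi, K, Ki, e, e', hH, hK, h⟩ := hFw.exists_conj hGw
      (fun i => by rw [hder, hcrit]; simp) hd (d' := -d') (fun t => by
        have := hd' (-(t + 2 * Real.pi))
        rw [show -(t + 2 * Real.pi) + 2 * Real.pi = -t by ring] at this
        rw [this]; push_cast; ring)
    exact ⟨_, _, K, Ki, _, e', IsEquivariantDiffeo.neg.comp hH, hK, h⟩

/-! ### Tuples, residues and legal permutations -/

/-- The residue of an integer as an index of a tuple. -/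
def residue {N : ℕ} (hN : 0 < N) (i : ℤ) : Fin N :=
  ⟨(i % N).toNat, by
    have := Int.emod_nonneg i (show (N : ℤ) ≠ 0 by omega)
    have := Int.emod_lt_of_pos i (show (0 : ℤ) < N by omega)
    omega⟩

theorem residue_coe {N : ℕ} (hN : 0 < N) (i : ℤ) : ((residue hN i : ℕ) : ℤ) = i % N :=
  Int.toNat_of_nonneg (Int.emod_nonneg i (by omega))

theorem residue_eq_iff {N : ℕ} (hN : 0 < N) (i : ℤ) (r : Fin N) :
    residue hN i = r ↔ (i : ZMod N) = ((r : ℕ) : ZMod N) := by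
  rw [← Int.cast_natCast (R := ZMod N), ZMod.intCast_eq_intCast_iff, Int.ModEq,
    ← residue_coe hN, Int.emod_eq_of_lt (by omega) (by exact_mod_cast r.2), Nat.cast_inj,
    Fin.ext_iff]

theorem residue_natCast {N : ℕ} (hN : 0 < N) (r : Fin N) : residue hN ((r : ℕ) : ℤ) = r :=
  (residue_eq_iff hN _ r).2 (by simp)

theorem position_residue {N : ℕ} (hN : 0 < N) (i : ℤ) :
    position (residue hN i) = (i : ZMod N) + 1 := by
  rw [position, Nat.cast_succ, ← (residue_eq_iff hN i _).1 rfl]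

/-- The extension of an increasing tuple of angles in `[0, 2π)` to all integers. -/
noncomputable def angleSeq {N : ℕ} (hN : 0 < N) (e : Fin N → ℝ) (i : ℤ) : ℝ :=
  e (residue hN i) + ((i / N : ℤ) : ℝ) * (2 * Real.pi)

theorem exp_angleSeq {N : ℕ} (hN : 0 < N) (e : Fin N → ℝ) (i : ℤ) :
    Circle.exp (angleSeq hN e i) = Circle.exp (e (residue hN i)) := by
  rw [angleSeq, Circle.exp_add, Circle.exp_int_mul_two_pi, mul_one]

theorem angleSeq_add_mul {N : ℕ} (hN : 0 < N) (e : Fin N → ℝ) (r : Fin N) (q : ℤ) :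
    angleSeq hN e ((r : ℕ) + q * N) = e r + q * (2 * Real.pi) := by
  have h1 : residue hN ((r : ℕ) + q * N) = r := (residue_eq_iff hN _ r).2 (by simp)
  have h2 : (((r : ℕ) : ℤ) + q * N) / N = q := by
    rw [Int.add_mul_ediv_right _ _ (by omega), Int.ediv_eq_zero_of_lt (by omega)
      (by exact_mod_cast r.2), zero_add]
  rw [angleSeq, h1, h2]

theorem isAngleSeq_angleSeq {N : ℕ} (hN : 0 < N) {e : Fin N → ℝ} (he : StrictMono e)
    (hI : ∀ r, e r ∈ Set.Ico 0 (2 * Real.pi)) : IsAngleSeq (angleSeq hN e) N := by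
  have hdecomp : ∀ i : ℤ, i = ((residue hN i : ℕ) : ℤ) + i / N * N := fun i => by
    rw [residue_coe]
    linarith [Int.emod_add_mul_ediv i N, mul_comm (i / (N : ℤ)) N]
  refine ⟨strictMono_int_of_lt_succ fun i => ?_, hN, fun i => ?_⟩
  · rw [hdecomp i]
    set r := residue hN i
    set q := i / (N : ℤ)
    rw [angleSeq_add_mul]
    by_cases h : (r : ℕ) + 1 < N
    · have := angleSeq_add_mul hN e ⟨r + 1, h⟩ q
      push_cast at this
      rw [add_right_comm, this]
      have : e r < e ⟨r + 1, h⟩ := he (Fin.mk_lt_mk.2 (Nat.lt_succ_self _))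
      linarith
    -- The last index of a period is followed by the first of the next; all angles lying in `[0,
    -- 2π)` keeps the order.
    · have h1 := angleSeq_add_mul hN e ⟨0, hN⟩ (q + 1)
      have h2 : (((⟨0, hN⟩ : Fin N) : ℕ) : ℤ) + (q + 1) * N = (r : ℕ) + q * N + 1 := by
        have := r.2
        have h3 : (r : ℕ) + 1 = N := by omega
        have h4 : ((r : ℕ) : ℤ) + 1 = N := by exact_mod_cast h3
        push_cast
        linarith
      rw [h2] at h1
      rw [h1]
      push_cast
      linarith [(hI r).2, (hI ⟨0, hN⟩).1]
  · have h1 := hdecomp i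
    have h2 : i + N = ((residue hN i : ℕ) : ℤ) + (i / N + 1) * N := by linarith
    rw [h2, angleSeq_add_mul]
    nth_rewrite 3 [h1]
    rw [angleSeq_add_mul]
    push_cast
    ring

theorem mem_range_angleSeq_iff {N : ℕ} (hN : 0 < N) {e : Fin N → ℝ} {M : Set Circle}
    (he : ∀ t, t ∈ Set.range e ↔ t ∈ Set.Ico 0 (2 * Real.pi) ∧ Circle.exp t ∈ M) (t : ℝ) :
    t ∈ Set.range (angleSeq hN e) ↔ Circle.exp t ∈ M := by
  constructor
  · rintro ⟨i, rfl⟩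
    rw [exp_angleSeq]
    exact ((he _).1 ⟨_, rfl⟩).2
  · intro h
    obtain ⟨y, hy, hty⟩ := Circle.periodic_exp.exists_mem_Ico₀ Real.two_pi_pos t
    obtain ⟨r, hr⟩ := (he y).2 ⟨hy, hty ▸ h⟩
    obtain ⟨q, hq⟩ := Circle.exp_eq_exp.1 hty
    exact ⟨(r : ℕ) + q * N, by rw [angleSeq_add_mul, hr, hq]⟩

/-- The angles of finitely many points of the circle form a periodic sequence. -/
theorem exists_isAngleSeq {V : Set Circle} (hV : V.Finite) (hne : V.Nonempty) :
    ∃ v : ℤ → ℝ, IsAngleSeq v V.ncard ∧ ∀ t, t ∈ Set.range v ↔ Circle.exp t ∈ V := by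
  set A : Set ℝ := {t | t ∈ Set.Ico 0 (2 * Real.pi) ∧ Circle.exp t ∈ V} with hA
  have hinj : Set.InjOn Circle.exp A :=
    (Circle.exp_injOn_Ico (a := 0) (by simp)).mono fun t ht => ht.1
  have himg : Circle.exp '' A = V := by
    ext x
    constructor
    · rintro ⟨t, ht, rfl⟩
      exact ht.2
    · intro hx
      obtain ⟨y, hy, hxy⟩ := Circle.periodic_exp.exists_mem_Ico₀ Real.two_pi_pos (Complex.arg x)
      rw [Circle.exp_arg] at hxy
      exact ⟨y, ⟨hy, hxy ▸ hx⟩, hxy.symm⟩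
  have hAf : A.Finite := Set.Finite.of_finite_image (himg ▸ hV) hinj
  have hcard : hAf.toFinset.card = V.ncard := by
    rw [← Set.ncard_eq_toFinset_card A hAf, ← himg, hinj.ncard_image]
  have hN : 0 < V.ncard := (Set.ncard_pos hV).2 hne
  set e := hAf.toFinset.orderEmbOfFin hcard with he
  have hr : ∀ t, t ∈ Set.range e ↔ t ∈ Set.Ico 0 (2 * Real.pi) ∧ Circle.exp t ∈ V := fun t => by
    rw [he, Finset.range_orderEmbOfFin, Set.Finite.coe_toFinset]; rfl
  exact ⟨angleSeq hN e, isAngleSeq_angleSeq hN e.strictMono fun r => ((hr _).1 ⟨r, rfl⟩).1,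
    mem_range_angleSeq_iff hN hr⟩

/-- Legal equivalence of tuples in terms of affine index changes. -/
theorem legalRel_iff {X : Type*} {N : ℕ} (hN : 0 < N) (t t' : Fin N → X) :
    LegalRel t t' ↔ ∃ s c : ℤ, (s = 1 ∨ s = -1) ∧
      ∀ i : ℤ, t (residue hN i) = t' (residue hN (s * i + c)) := by
  constructor
  · rintro ⟨ρ, ⟨σ, τ, ⟨α, hα⟩, hτ, rfl⟩, h⟩
    obtain ⟨c, rfl⟩ := ZMod.intCast_surjective α
    have hs : ∃ s : ℤ, (s = 1 ∨ s = -1) ∧ ∀ x, τ x = s * x := by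
      rcases hτ with rfl | rfl
      · exact ⟨1, Or.inl rfl, fun x => by simp⟩
      · exact ⟨-1, Or.inr rfl, fun x => by simp [reversation]⟩
    obtain ⟨s, hs, hτs⟩ := hs
    -- Positions count from 1 and residues from 0: `s * (i + 1) + c = (s * i + (s + c - 1)) + 1`.
    refine ⟨s, s + c - 1, hs, fun i => h _ _ ?_⟩
    rw [position_residue, position_residue, Equiv.Perm.mul_apply, hα, hτs]
    push_cast
    ring
  · rintro ⟨s, c, hs, h⟩
    have hτ : ∃ τ : Equiv.Perm (ZMod N), (τ = 1 ∨ τ = reversation N) ∧ ∀ x, τ x = s * x := by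
      rcases hs with rfl | rfl
      · exact ⟨1, Or.inl rfl, fun x => by simp⟩
      · exact ⟨reversation N, Or.inr rfl, fun x => by simp [reversation]⟩
    obtain ⟨τ, hτ, hτs⟩ := hτ
    refine ⟨Equiv.addRight ((c - s + 1 : ℤ) : ZMod N) * τ,
      ⟨_, τ, ⟨((c - s + 1 : ℤ) : ZMod N), fun x => rfl⟩, hτ, rfl⟩, fun i j hij => ?_⟩
    have h1 := h (i : ℕ)
    rw [residue_natCast] at h1
    rw [h1]
    congr 1
    rw [residue_eq_iff]
    rw [Equiv.Perm.mul_apply, hτs, Equiv.coe_addRight, position, position] at hij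
    push_cast at hij ⊢
    linear_combination -hij

/-! ### Marked points of a map with simple folds -/

theorem eventually_ne_of_isMorse {F : ℝ → ℝ} (hF : ContDiff ℝ ∞ F) (hM : IsMorse F) (x c : ℝ) :
    ∀ᶠ y in nhdsWithin x {x}ᶜ, F y ≠ c := by
  by_cases h : F x = c
  · by_cases h1 : deriv F x = 0
    · obtain ⟨σ, ψ, hσ, hψ, hpos, hev⟩ := exists_fold_normal_form hF h1 (hM x h1)
      filter_upwards [hev.filter_mono nhdsWithin_le_nhds,
        (hψ.continuousAt.eventually (lt_mem_nhds hpos)).filter_mono nhdsWithin_le_nhds,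
        self_mem_nhdsWithin] with y h1 h2 h3 h4
      have h5 : y - x ≠ 0 := sub_ne_zero.2 h3
      have h6 : σ ≠ 0 := by rcases hσ with rfl | rfl <;> norm_num
      have h7 : σ * ((y - x) * ψ y) ^ 2 = 0 := by linarith
      simp [h5, h6, h2.ne'] at h7
    · exact (hasDerivAt_of_contDiff hF x).eventually_ne h1
  · exact (hF.continuous.continuousAt.eventually_ne h).filter_mono nhdsWithin_le_nhds

/-- Close to `x` the lift moves by less than `2π`, so a repeated value on the circle would be a
repeated value of the lift. -/
theorem eventually_exp_ne_of_isMorse {F : ℝ → ℝ} (hF : ContDiff ℝ ∞ F) (hM : IsMorse F) (x : ℝ)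
    (z : Circle) : ∀ᶠ y in nhdsWithin x {x}ᶜ, Circle.exp (F y) ≠ z := by
  by_cases h : Circle.exp (F x) = z
  · have hnear : ∀ᶠ y in nhds x, |F y - F x| < 2 * Real.pi := by
      have hc : Continuous fun y => |F y - F x| := by
        have := hF.continuous
        fun_prop
      exact hc.continuousAt.eventually (gt_mem_nhds (by simpa using Real.pi_pos))
    filter_upwards [eventually_ne_of_isMorse hF hM x (F x), hnear.filter_mono nhdsWithin_le_nhds]
      with y h1 h2 h3
    obtain ⟨n, hn⟩ := Circle.exp_eq_exp.1 (h3.trans h.symm)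
    rw [hn, add_sub_cancel_left, abs_mul, abs_of_pos Real.two_pi_pos,
      mul_lt_iff_lt_one_left Real.two_pi_pos] at h2
    have h4 : |n| < 1 := by exact_mod_cast h2
    rw [Int.abs_lt_one_iff.1 h4] at hn
    exact h1 (by simpa using hn)
  · have hc : Continuous fun y => Circle.exp (F y) := Circle.exp.continuous.comp hF.continuous
    exact (hc.continuousAt.eventually_ne h).filter_mono nhdsWithin_le_nhds

open scoped Classical in
/-- The points of the target whose preimages are marked. -/
def markedValues (f : SmoothMap) : Set Circle :=
  if singularSet f = ∅ then {1} else discriminant f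

theorem markedPoints_eq (f : SmoothMap) : markedPoints f = f ⁻¹' markedValues f := by
  unfold markedPoints markedValues
  split_ifs <;> rfl

theorem markedValues_nonempty (f : SmoothMap) : (markedValues f).Nonempty := by
  unfold markedValues
  split_ifs with h
  · exact ⟨1, rfl⟩
  · exact (Set.nonempty_iff_ne_empty.2 h).image f

theorem singularSet_subset_markedPoints (f : SmoothMap) : singularSet f ⊆ markedPoints f := by
  intro x hx
  unfold markedPoints
  rw [if_neg (Set.nonempty_iff_ne_empty.1 ⟨x, hx⟩)]
  exact ⟨x, hx, rfl⟩

/-- A circle map without singular points is surjective. -/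
theorem surjective_of_singularSet_eq_empty {f : SmoothMap} (h : singularSet f = ∅) :
    Function.Surjective f := by
  obtain ⟨F, hF⟩ := exists_isLift_smoothMap f
  obtain ⟨d, hd⟩ := hF.exists_degree
  have hne : ∀ t, deriv F t ≠ 0 := fun t h0 => by
    have := (hF.mem_singularSet_iff t).2 h0
    rw [h] at this
    exact this
  have hd0 : d ≠ 0 := by
    rintro rfl
    -- Rolle's theorem: a lift of degree zero has a critical point.
    obtain ⟨t, -, ht⟩ := exists_deriv_eq_zero (f := F)
      (show (0 : ℝ) < 0 + 2 * Real.pi by positivity) hF.contDiff.continuous.continuousOn (by rw [hd]; simp)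
    exact hne t ht
  have hper := map_add_int_mul hd
  intro y
  -- A translation by `n * d` periods adds `n * d²` periods to `F`, which has the sign of `n`
  -- whatever the sign of `d`.
  have hp : 0 < (d : ℝ) * d * (2 * Real.pi) := by
    have : (d : ℝ) ≠ 0 := by exact_mod_cast hd0
    have := mul_self_pos.2 this
    positivity
  obtain ⟨t, ht⟩ : Complex.arg y ∈ Set.range F := by
    refine mem_range_of_exists_le_of_exists_ge hF.contDiff.continuous ?_ ?_
    · obtain ⟨n, hn⟩ := exists_int_lt ((Complex.arg y - F 0) / (d * d * (2 * Real.pi)))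
      rw [lt_div_iff₀ hp] at hn
      refine ⟨0 + (n * d : ℤ) * (2 * Real.pi), ?_⟩
      rw [hper]; push_cast; linarith
    · obtain ⟨n, hn⟩ := exists_int_gt ((Complex.arg y - F 0) / (d * d * (2 * Real.pi)))
      rw [div_lt_iff₀ hp] at hn
      refine ⟨0 + (n * d : ℤ) * (2 * Real.pi), ?_⟩
      rw [hper]; push_cast; linarith
  exact ⟨Circle.exp t, by rw [hF.map_exp, ht, Circle.exp_arg]⟩

theorem markedPoints_nonempty (f : SmoothMap) : (markedPoints f).Nonempty := by
  by_cases h : singularSet f = ∅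
  · obtain ⟨x, hx⟩ := surjective_of_singularSet_eq_empty h 1
    exact ⟨x, by simp [markedPoints, h, hx]⟩
  · exact (Set.nonempty_iff_ne_empty.2 h).mono (singularSet_subset_markedPoints f)

/-- The increasing enumeration of the marked angles. -/
noncomputable def angle (f : SmoothMap) : Fin (N f) → ℝ :=
  (angles f).orderEmbOfFin rfl

namespace HasSimpleFolds

variable {f g : SmoothMap}

theorem finite_singularSet (hf : HasSimpleFolds f) : (singularSet f).Finite := by
  obtain ⟨F, hF⟩ := exists_isLift_smoothMap f
  exact CircleMaps.finite_singularSet hF (hf.isMorse F hF)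

theorem finite_markedValues (hf : HasSimpleFolds f) : (markedValues f).Finite := by
  unfold markedValues
  split_ifs
  · exact Set.finite_singleton _
  · exact hf.finite_singularSet.image f

theorem finite_angleSet (hf : HasSimpleFolds f) : (angleSet f).Finite := by
  obtain ⟨F, hF⟩ := exists_isLift_smoothMap f
  have h := finite_of_forall_eventually_ne (K := Set.Icc 0 (2 * Real.pi)) isCompact_Icc
    (P := fun t => Circle.exp (F t) ∈ markedValues f) (fun x _ => by
      have h1 := (Filter.eventually_all_finite hf.finite_markedValues).2 fun z _ =>
        eventually_exp_ne_of_isMorse hF.contDiff (hf.isMorse F hF) x z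
      filter_upwards [h1] with y hy hy' using hy _ hy' rfl)
  refine h.subset fun t ht => ⟨Set.Ico_subset_Icc_self ht.1, ?_⟩
  have := ht.2
  rw [markedPoints_eq] at this
  rw [← hF.map_exp]
  exact this

theorem mem_range_angle (hf : HasSimpleFolds f) (t : ℝ) :
    t ∈ Set.range (angle f) ↔ t ∈ Set.Ico 0 (2 * Real.pi) ∧ Circle.exp t ∈ markedPoints f := by
  -- Finiteness rules out the default value `∅` of `angles`.
  have h1 : angles f = hf.finite_angleSet.toFinset := dif_pos hf.finite_angleSet
  have h2 : Set.range (angle f) = (angles f : Set ℝ) := Finset.range_orderEmbOfFin _ rfl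
  rw [h2, h1, Set.Finite.coe_toFinset]
  rfl

theorem N_pos (hf : HasSimpleFolds f) : 0 < N f := by
  obtain ⟨x, hx⟩ := markedPoints_nonempty f
  obtain ⟨y, hy, hxy⟩ := Circle.periodic_exp.exists_mem_Ico₀ Real.two_pi_pos (Complex.arg x)
  rw [Circle.exp_arg] at hxy
  obtain ⟨r, -⟩ := (hf.mem_range_angle y).2 ⟨hy, hxy ▸ hx⟩
  exact r.pos

/-- The periodic sequence of all marked angles. -/
theorem isAngleSeq (hf : HasSimpleFolds f) : IsAngleSeq (angleSeq hf.N_pos (angle f)) (N f) :=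
  isAngleSeq_angleSeq _ ((angles f).orderEmbOfFin rfl).strictMono
    fun r => ((hf.mem_range_angle _).1 ⟨r, rfl⟩).1

theorem mem_range_angleSeq (hf : HasSimpleFolds f) (t : ℝ) :
    t ∈ Set.range (angleSeq hf.N_pos (angle f)) ↔ Circle.exp t ∈ markedPoints f :=
  mem_range_angleSeq_iff _ hf.mem_range_angle t

theorem ast_eq_s_iff (r : Fin (N f)) :
    Ast f r = Letter.s ↔ Circle.exp (angle f r) ∈ singularSet f := by
  change letterAt f (angle f r) = Letter.s ↔ _
  unfold letterAt
  split_ifs with h <;> simp [h]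

theorem ast_residue_eq_s_iff (hf : HasSimpleFolds f) (i : ℤ) :
    Ast f (residue hf.N_pos i) = Letter.s ↔
      Circle.exp (angleSeq hf.N_pos (angle f) i) ∈ singularSet f := by
  rw [ast_eq_s_iff, exp_angleSeq]

theorem ncard_singularSet (hf : HasSimpleFolds f) :
    (singularSet f).ncard = {r | Ast f r = Letter.s}.ncard := by
  have h1 : singularSet f = (fun r => Circle.exp (angle f r)) '' {r | Ast f r = Letter.s} := by
    ext x
    constructor
    · intro hx
      obtain ⟨y, hy, hxy⟩ := Circle.periodic_exp.exists_mem_Ico₀ Real.two_pi_pos (Complex.arg x)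
      rw [Circle.exp_arg] at hxy
      obtain ⟨r, hr⟩ := (hf.mem_range_angle y).2
        ⟨hy, hxy ▸ singularSet_subset_markedPoints f hx⟩
      refine ⟨r, (ast_eq_s_iff r).2 ?_, ?_⟩
      · rwa [hr, ← hxy]
      · simp only [hr, ← hxy]
    · rintro ⟨r, hr, rfl⟩
      exact (ast_eq_s_iff r).1 hr
  rw [h1]
  refine Set.ncard_image_of_injective _ fun r r' h => ?_
  refine ((angles f).orderEmbOfFin rfl).injective
    (Circle.exp_injOn_Ico (a := 0) (b := 2 * Real.pi) (by simp) ?_ ?_ h)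
  · exact ((hf.mem_range_angle _).1 ⟨r, rfl⟩).1
  · exact ((hf.mem_range_angle _).1 ⟨r', rfl⟩).1

/-- Distinct folds have distinct values; the 1 accounts for the base value used when there are no
folds. Together with `ncard_singularSet` this reads the number of marked values off the tuple. -/
theorem ncard_markedValues (hf : HasSimpleFolds f) :
    (markedValues f).ncard = max 1 (singularSet f).ncard := by
  unfold markedValues
  split_ifs with h
  · simp [h]
  · rw [discriminant, hf.injOn.ncard_image]
    have := (Set.ncard_pos hf.finite_singularSet).2 (Set.nonempty_iff_ne_empty.2 h)
    omega

end HasSimpleFolds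

/-! ### The two implications -/

/-- The induced map on indices is an increasing bijection of `ℤ`, hence a translation; comparing
periods gives `N = N'`. -/
theorem IsAngleSeq.eq_shift_of_strictMono {a b : ℤ → ℝ} {N N' : ℕ} (ha : IsAngleSeq a N)
    (hb : IsAngleSeq b N') {H Hi : ℝ → ℝ} (hH : IsEquivariantDiffeo H Hi 1)
    (h : ∀ t, t ∈ Set.range a ↔ H t ∈ Set.range b) :
    N = N' ∧ ∃ c, ∀ i, H (a i) = b (i + c) := by
  have hφ : ∀ i, ∃ j, b j = H (a i) := fun i => (h (a i)).1 ⟨i, rfl⟩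
  choose φ hφ using hφ
  have hmono : StrictMono φ := fun i j hij => by
    rw [← hb.strictMono.lt_iff_lt, hφ, hφ]
    exact hH.strictMono (ha.strictMono hij)
  have hsurj : Function.Surjective φ := fun j => by
    obtain ⟨i, hi⟩ := (h (Hi (b j))).2 ⟨j, (hH.right_inv _).symm⟩
    exact ⟨i, hb.strictMono.injective (by rw [hφ, hi, hH.right_inv])⟩
  have hstep : ∀ i, φ (i + 1) = φ i + 1 := fun i => by
    obtain ⟨k, hk⟩ := hsurj (φ i + 1)
    have h1 : i < k := hmono.lt_iff_lt.1 (by omega)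
    have h2 : φ i < φ (i + 1) := hmono (by omega)
    have h3 : φ (i + 1) ≤ φ k := hmono.monotone (by omega)
    omega
  have hφi : ∀ i, φ i = i + φ 0 := fun i => by
    induction i using Int.induction_on with
    | zero => simp
    | succ n ih => rw [hstep, ih]; ring
    | pred n ih =>
      have := hstep (-n - 1)
      rw [sub_add_cancel] at this
      omega
  refine ⟨?_, φ 0, fun i => by rw [← hφ, hφi]⟩
  have h1 := hH.add_period (a 0)
  rw [← ha.add_period, Int.cast_one, one_mul, ← hφ, ← hφ, ← hb.add_period] at h1
  have h2 := hb.strictMono.injective h1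
  rw [hφi] at h2
  omega

/-- An equivariant diffeomorphism matching two periodic sequences acts on the indices as an affine
map. -/
theorem IsAngleSeq.eq_affine {a b : ℤ → ℝ} {N N' : ℕ} (ha : IsAngleSeq a N)
    (hb : IsAngleSeq b N') {H Hi : ℝ → ℝ} {e : ℤ} (hH : IsEquivariantDiffeo H Hi e)
    (h : ∀ t, t ∈ Set.range a ↔ H t ∈ Set.range b) :
    N = N' ∧ ∃ s c : ℤ, (s = 1 ∨ s = -1) ∧ ∀ i, H (a i) = b (s * i + c) := by
  rcases hH.sign with rfl | rfl
  · obtain ⟨hN, c, hc⟩ := ha.eq_shift_of_strictMono hb hH h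
    exact ⟨hN, 1, c, Or.inl rfl, fun i => by rw [hc, one_mul]⟩
  · obtain ⟨hN, c, hc⟩ := ha.eq_shift_of_strictMono hb.reflect (IsEquivariantDiffeo.neg.comp hH)
      (fun t => by
        rw [h]
        constructor
        · rintro ⟨i, hi⟩
          exact ⟨-i, by simp [hi]⟩
        · rintro ⟨i, hi⟩
          exact ⟨-i, neg_inj.1 hi⟩)
    exact ⟨hN, -1, -c, Or.inr rfl, fun i => by
      rw [← neg_inj, hc]; congr 2; ring⟩

theorem cast_residue {N N' : ℕ} (h : N = N') (hN : 0 < N) (hN' : 0 < N') (i : ℤ) :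
    Fin.cast h (residue hN i) = residue hN' i := by
  subst h
  rfl

/-- Tuples that agree up to an affine index change contain every letter equally often. -/
theorem ncard_setOf_eq_of_pattern {X : Type*} {N N' : ℕ} (h : N = N') (hN : 0 < N) (hN' : 0 < N')
    {t : Fin N → X} {t' : Fin N' → X} {s c : ℤ} (hs : s = 1 ∨ s = -1)
    (hc : ∀ i, t (residue hN i) = t' (residue hN' (s * i + c))) (x : X) :
    {r | t r = x}.ncard = {r | t' r = x}.ncard := by
  subst h
  set P : Fin N → Fin N := fun r => residue hN (s * (r : ℕ) + c) with hP
  have hinj : Function.Injective P := fun r r' hr => by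
    have h1 := (residue_eq_iff hN _ _).1 hr
    rw [← (residue_eq_iff hN (s * (r' : ℕ) + c) _).1 rfl] at h1
    rw [← residue_natCast hN r, residue_eq_iff]
    push_cast at h1 ⊢
    have hss : (s : ZMod N) * s = 1 := by rcases hs with rfl | rfl <;> simp
    linear_combination (s : ZMod N) * h1 + (((r' : ℕ) : ZMod N) - ((r : ℕ) : ZMod N)) * hss
  have himg : {r | t' r = x} = P '' {r | t r = x} := by
    ext r
    obtain ⟨r', rfl⟩ := Finite.surjective_of_injective hinj r
    have h1 := hc (r' : ℕ)
    rw [residue_natCast] at h1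
    rw [hinj.mem_set_image, Set.mem_ofPred_eq, Set.mem_ofPred_eq, h1]
  rw [himg, Set.ncard_image_of_injective _ hinj]

namespace HasSimpleFolds

variable {f g : SmoothMap}

theorem exists_isFoldWalk_lift (hf : HasSimpleFolds f) {F : ℝ → ℝ} (hF : IsLift F f) :
    ∃ (a v : ℤ → ℝ) (ε w : ℤ → ℤ), IsFoldWalk F a (N f) v (markedValues f).ncard ε w := by
  obtain ⟨v, hv, hvr⟩ := exists_isAngleSeq hf.finite_markedValues (markedValues_nonempty f)
  obtain ⟨ε, w, h⟩ := exists_isFoldWalk hf.isAngleSeq hv hF.contDiff (hf.isMorse F hF)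
    (fun t => by
      rw [hf.mem_range_angleSeq, hvr, markedPoints_eq, Set.mem_preimage, hF.map_exp])
    (fun t ht => (hf.mem_range_angleSeq t).2
      (singularSet_subset_markedPoints f ((hF.mem_singularSet_iff t).2 ht)))
  exact ⟨_, v, ε, w, h⟩

/-- The number of marked points of an immersion is its absolute degree. -/
theorem N_eq_natAbs_degree (hf : HasSimpleFolds f) (h : singularSet f = ∅) {F : ℝ → ℝ}
    (hF : IsLift F f) {d : ℤ} (hd : ∀ t, F (t + 2 * Real.pi) = F t + d * (2 * Real.pi)) :
    N f = d.natAbs := by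
  obtain ⟨a, v, ε, w, hw⟩ := hf.exists_isFoldWalk_lift hF
  have h1 := hw.degree_mul_eq (fun t h0 => by
    have := (hF.mem_singularSet_iff t).2 h0
    rw [h] at this
    exact this) hd
  have h2 : (markedValues f).ncard = 1 := by simp [markedValues, h]
  rw [h2] at h1
  rcases hw.sign 0 with h3 | h3 <;> rw [h3] at h1 <;> omega

theorem legalRel_of_smoothEquiv (hf : HasSimpleFolds f) (hg : HasSimpleFolds g)
    (h : SmoothEquiv f g) :
    ∃ hN : N f = N g, LegalRel (Ast f) (fun i : Fin (N f) => Ast g (Fin.cast hN i)) := by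
  obtain ⟨φ, ψ, hφψ⟩ := h
  obtain ⟨F, hF⟩ := exists_isLift_smoothMap f
  obtain ⟨G, hG⟩ := exists_isLift_smoothMap g
  have hS := mem_singularSet_iff_of_conj hφψ
  have hempty : singularSet f = ∅ ↔ singularSet g = ∅ := by
    simp only [Set.eq_empty_iff_forall_notMem, hS]
    exact ⟨fun h x => by simpa using h (φ.symm x), fun h x => h (φ x)⟩
  have heq : ∀ x y : Letter, (x = Letter.s ↔ y = Letter.s) → x = y := by
    rintro (_ | _) (_ | _) h <;> simp at h ⊢
  by_cases h0 : singularSet f = ∅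
  · obtain ⟨d, hd⟩ := hF.exists_degree
    obtain ⟨d', hd'⟩ := hG.exists_degree
    obtain ⟨H, Hi, K, Ki, e, e', hH, hK, hc⟩ := (smoothEquiv_iff hF hG).1 ⟨φ, ψ, hφψ⟩
    -- The base value 1 may be moved by `ψ`, so the counts are compared through the degrees, which
    -- agree up to sign.
    have hN : N f = N g := by
      rw [hf.N_eq_natAbs_degree h0 hF hd, hg.N_eq_natAbs_degree (hempty.1 h0) hG hd']
      have h1 := hc (0 + 2 * Real.pi)
      rw [hd, hH.add_period, map_add_int_mul hK.add_period, map_add_int_mul hd', hc] at h1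
      have h2 : ((d * e' : ℤ) : ℝ) * (2 * Real.pi) = ((e * d' : ℤ) : ℝ) * (2 * Real.pi) := by
        push_cast; linarith
      have h3 : d * e' = e * d' := by
        exact_mod_cast mul_right_cancel₀ Real.two_pi_pos.ne' h2
      rcases hH.sign with rfl | rfl <;> rcases hK.sign with rfl | rfl <;> omega
    refine ⟨hN, (legalRel_iff hf.N_pos _ _).2 ⟨1, 0, Or.inl rfl, fun i => heq _ _ ?_⟩⟩
    rw [ast_eq_s_iff, ast_eq_s_iff, h0, hempty.1 h0]
    exact iff_of_false (Set.notMem_empty _) (Set.notMem_empty _)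
  · obtain ⟨H, Hi, e, hH, hHl⟩ := exists_isEquivariantDiffeo φ
    have hM : ∀ x, x ∈ markedPoints f ↔ φ x ∈ markedPoints g := fun x => by
      rw [markedPoints_eq, markedPoints_eq, markedValues, markedValues, if_neg h0,
        if_neg fun h => h0 (hempty.2 h), Set.mem_preimage, Set.mem_preimage, ← hφψ]
      constructor
      · rintro ⟨y, hy, hyx⟩
        exact ⟨φ y, (hS y).1 hy, by rw [← hφψ, hyx]⟩
      · rintro ⟨y, hy, hyx⟩
        have hz := φ.apply_symm_apply y
        refine ⟨φ.symm y, (hS _).2 (by rwa [hz]), ?_⟩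
        have h1 : ψ (f (φ.symm y)) = ψ (f x) := by rw [hφψ, hz, hyx]
        exact ψ.injective h1
    obtain ⟨hN, s, c, hs, hc⟩ := hf.isAngleSeq.eq_affine hg.isAngleSeq hH (fun t => by
      rw [hf.mem_range_angleSeq, hg.mem_range_angleSeq, hM, hHl.map_exp])
    refine ⟨hN, (legalRel_iff hf.N_pos _ _).2 ⟨s, c, hs, fun i => heq _ _ ?_⟩⟩
    rw [cast_residue hN hf.N_pos hg.N_pos, hf.ast_residue_eq_s_iff, hg.ast_residue_eq_s_iff,
      hS, hHl.map_exp, hc]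

theorem smoothEquiv_of_legalRel (hf : HasSimpleFolds f) (hg : HasSimpleFolds g)
    (hN : N f = N g) (h : LegalRel (Ast f) (fun i : Fin (N f) => Ast g (Fin.cast hN i))) :
    SmoothEquiv f g := by
  obtain ⟨F, hF⟩ := exists_isLift_smoothMap f
  obtain ⟨G, hG⟩ := exists_isLift_smoothMap g
  obtain ⟨d, hd⟩ := hF.exists_degree
  obtain ⟨d', hd'⟩ := hG.exists_degree
  obtain ⟨s, c, hs, hc⟩ := (legalRel_iff hf.N_pos _ _).1 h
  simp only [cast_residue hN hf.N_pos hg.N_pos] at hc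
  -- Counting letters `s` gives equally many marked values on both sides, which the matching of
  -- value sequences requires.
  have hcard : (singularSet f).ncard = (singularSet g).ncard := by
    rw [hf.ncard_singularSet, hg.ncard_singularSet]
    exact ncard_setOf_eq_of_pattern hN hf.N_pos hg.N_pos hs hc Letter.s
  have hval : (markedValues f).ncard = (markedValues g).ncard := by
    rw [hf.ncard_markedValues, hg.ncard_markedValues, hcard]
  obtain ⟨v, hv, hvr⟩ := exists_isAngleSeq hf.finite_markedValues (markedValues_nonempty f)
  obtain ⟨u, hu, hur⟩ := exists_isAngleSeq hg.finite_markedValues (markedValues_nonempty g)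
  rw [← hval] at hu
  have hb : IsAngleSeq (angleSeq hg.N_pos (angle g)) (N f) := by
    rw [hN]
    exact hg.isAngleSeq
  rw [smoothEquiv_iff hF hG]
  exact exists_conj_of_pattern hf.isAngleSeq hb hv hu hF.contDiff
    hG.contDiff (hf.isMorse F hF) (hg.isMorse G hG)
    (fun t => by
      rw [hf.mem_range_angleSeq, hvr, markedPoints_eq, Set.mem_preimage, hF.map_exp])
    (fun t => by
      rw [hg.mem_range_angleSeq, hur, markedPoints_eq, Set.mem_preimage, hG.map_exp])
    (fun t ht => (hf.mem_range_angleSeq t).2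
      (singularSet_subset_markedPoints f ((hF.mem_singularSet_iff t).2 ht)))
    (fun t ht => (hg.mem_range_angleSeq t).2
      (singularSet_subset_markedPoints g ((hG.mem_singularSet_iff t).2 ht)))
    hd hd' hs (fun i => by
      rw [← hF.mem_singularSet_iff, ← hG.mem_singularSet_iff, ← hf.ast_residue_eq_s_iff,
        ← hg.ast_residue_eq_s_iff, hc])

end HasSimpleFolds

end CircleMaps

theorem theoremT (f g : CircleMaps.SmoothMap)
    (hf : CircleMaps.IsStable f) (hg : CircleMaps.IsStable g) :
    CircleMaps.SmoothEquiv f g ↔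
      ∃ hN : CircleMaps.N f = CircleMaps.N g,
        CircleMaps.LegalRel (CircleMaps.Ast f)
          (fun i : Fin (CircleMaps.N f) => CircleMaps.Ast g (Fin.cast hN i)) :=
  ⟨hf.hasSimpleFolds.legalRel_of_smoothEquiv hg.hasSimpleFolds,
    fun ⟨hN, h⟩ => hf.hasSimpleFolds.smoothEquiv_of_legalRel hg.hasSimpleFolds hN h⟩
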